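/- For a graph $G$ on $n\ge 2$ vertices let $\lambda_1(G)\ge\lambda_2(G)\ge\dots\ge\lambda_n(G)$ be the eigenvalues of its adjacency matrix, listed with multiplicity, and call $\lambda_1(G)+\lambda_2(G)$ the spectral sum of $G$. If $n\ge 16$, then the path $P_n$ is, up to isomorphism, the unique tree of minimum spectral sum among all trees on $n$ vertices. If $2\le n\le 15$, then the star $K_{1,n-1}$ is, up to isomorphism, the unique tree of minimum spectral sum among all trees on $n$ vertices. -/

import Mathlib

namespace TreeSpectralSum

open Classical in
/-- The adjacency eigenvalues of a finite simple graph on `V`, with multiplicity and in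
non-increasing order, listed by `Fin (Fintype.card V)`; so index `0` gives the largest one. -/
noncomputable def adjEigenvalues {V : Type*} [Fintype V] (G : SimpleGraph V) :
    Fin (Fintype.card V) → ℝ :=
  (SimpleGraph.isHermitian_adjMatrix (R := ℝ) G).eigenvalues₀

/-- The spectral sum `λ₁(G) + λ₂(G)`, the sum of the two largest adjacency eigenvalues (with
multiplicity). It is meaningful for graphs with at least two vertices, and is set to `0` for
smaller ones. -/
noncomputable def spectralSum {V : Type*} [Fintype V] (G : SimpleGraph V) : ℝ :=
  if h : 2 ≤ Fintype.card V then
    adjEigenvalues G ⟨0, by omega⟩ + adjEigenvalues G ⟨1, by omega⟩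
  else 0

/-- `T` is a tree whose spectral sum is least among all trees with the same number of vertices
(every such tree is isomorphic to one on the vertex set of `T`). -/
def IsMinTree {V : Type*} [Fintype V] (T : SimpleGraph V) : Prop :=
  T.IsTree ∧ ∀ T' : SimpleGraph V, T'.IsTree → spectralSum T ≤ spectralSum T'

end TreeSpectralSum

namespace TreeSpectralSum

/-! The engine is a comparison of branches with paths. If no weighting has Rayleigh quotient at
least `L`, then `L - A` is positive definite and has a strict supersolution `x` that is positive
everywhere (`formBound_or_exists_supersolution`). Write r_c for `pathRatio L c`. Since r is
subadditive (`PathPos.merge`), eliminating vertices from the leaves inward gives x_w ≥ r_c · x_u for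
each edge `u w` whose branch beyond `u` has c vertices (`pathRatio_card_branch_le`). Hence λ₁ ≥ L as
soon as the numbers r_c, summed over the branches at one vertex, reach L. A determinant version
works at an edge.

For λ₂, let N be the largest size such that some vertex has two branches with at least N vertices.
These branches are disjoint and not adjacent, so λ₂ ≥ 2cos(π/(N+1)). By maximality there is a
central vertex all of whose branches have at most N vertices, or a central edge whose endpoints have
this property away from the edge (`exists_center`). If n is large compared with N, the centre has
many branches and λ₁ is forced up; if n is close to 2N, the bound on λ₂ is nearly that of the path.

For n ≥ 16 the value to beat is 2cos(π/(n+1)) + 2cos(2π/(n+1)) < 4. When N ≤ 6 this is a finite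
computation below n = 43, and beyond that λ₁ + λ₂ ≥ 4 (`goalUB_le_of_level_le_six`). When N ≥ 7,
Taylor bounds settle every degree pattern at the centre. In the tight cases n = 2N+1 and n = 2N+2 a
branch vertex gives λ₁ ≥ 2cos(π/(2(n-1))), by comparison with the path forked at one end
(`two_mul_cos_le_adjEigenvalues_zero`). A tree without a branch vertex is a path.

For n ≤ 15 the star has λ₁ ≤ √(n-1) and λ₂ ≤ 0. A tree with N = 1 is a star or a double star, the
latter being treated by Ky Fan's inequality; the other values of N are again a finite computation
(`sqrt_lt_spectralSum`). -/

open Classical in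
/-- The adjacency operator applied to a vertex weighting. -/
noncomputable def adjSum {V : Type*} [Fintype V] (G : SimpleGraph V) (x : V → ℝ) (v : V) : ℝ :=
  ∑ w ∈ G.neighborFinset v, x w

/-- The quadratic form of the adjacency matrix. -/
noncomputable def adjForm {V : Type*} [Fintype V] (G : SimpleGraph V) (x : V → ℝ) : ℝ :=
  ∑ v, x v * adjSum G x v

/-! ### Variational bounds for the two largest eigenvalues -/

section Spectral

variable {V : Type*} [Fintype V] (G : SimpleGraph V)

open Classical in
lemma adjMatrix_mulVec_eq (x : V → ℝ) :
    Matrix.mulVec (G.adjMatrix ℝ) x = adjSum G x := by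
  funext v
  simp [adjSum]

lemma exists_eigenbasis :
    ∃ b : Fin (Fintype.card V) → V → ℝ,
      (∀ i, adjSum G (b i) = adjEigenvalues G i • b i) ∧
      (∀ i j, ∑ v, b i v * b j v = if i = j then 1 else 0) ∧
      (∀ x : V → ℝ, ∑ v, x v ^ 2 = ∑ i, (∑ v, b i v * x v) ^ 2) ∧
      (∀ x : V → ℝ, adjForm G x = ∑ i, adjEigenvalues G i * (∑ v, b i v * x v) ^ 2) := by
  classical
  set hA := SimpleGraph.isHermitian_adjMatrix (R := ℝ) G with hA_def
  set e := (Fintype.equivOfCardEq (Fintype.card_fin (Fintype.card V)) :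
    Fin (Fintype.card V) ≃ V) with he
  have hev : ∀ i, hA.eigenvalues (e i) = adjEigenvalues G i := by
    intro i
    unfold adjEigenvalues Matrix.IsHermitian.eigenvalues
    rw [← he, Equiv.symm_apply_apply]
  have hinner : ∀ x y : EuclideanSpace ℝ V, inner ℝ x y = ∑ v, x v * y v := by
    intro x y
    simp [PiLp.inner_apply, mul_comm]
  have hmul : ∀ i, adjSum G (fun v => hA.eigenvectorBasis (e i) v)
      = adjEigenvalues G i • (fun v => hA.eigenvectorBasis (e i) v) := by
    intro i
    have := hA.mulVec_eigenvectorBasis (e i)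
    rw [hev, adjMatrix_mulVec_eq] at this
    exact this
  have horth : ∀ i j, ∑ v, hA.eigenvectorBasis (e i) v * hA.eigenvectorBasis (e j) v
      = if i = j then 1 else 0 := by
    intro i j
    rw [← hinner, orthonormal_iff_ite.mp hA.eigenvectorBasis.orthonormal]
    simp
  have hexp : ∀ x : V → ℝ, ∀ v, x v
      = ∑ i, (∑ v, hA.eigenvectorBasis (e i) v * x v) * hA.eigenvectorBasis (e i) v := by
    intro x v
    have h := hA.eigenvectorBasis.sum_repr (WithLp.toLp 2 x)
    have h2 := congrArg (fun z : EuclideanSpace ℝ V => z v) h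
    simp only [OrthonormalBasis.repr_apply_apply, hinner] at h2
    rw [← Equiv.sum_comp e] at h2
    simp at h2
    exact h2.symm
  have hsym : ∀ x : V → ℝ, ∀ i, ∑ v, hA.eigenvectorBasis (e i) v * adjSum G x v
      = adjEigenvalues G i * ∑ v, hA.eigenvectorBasis (e i) v * x v := by
    intro x i
    have h1 : ∑ v, hA.eigenvectorBasis (e i) v * adjSum G x v
        = ∑ v, adjSum G (fun v => hA.eigenvectorBasis (e i) v) v * x v := by
      have := Matrix.dotProduct_mulVec (fun v => hA.eigenvectorBasis (e i) v) (G.adjMatrix ℝ) x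
      rw [← Matrix.mulVec_transpose, SimpleGraph.transpose_adjMatrix, adjMatrix_mulVec_eq,
        adjMatrix_mulVec_eq] at this
      exact this
    rw [h1, hmul, Finset.mul_sum]
    exact Finset.sum_congr rfl fun v _ => by simp [mul_assoc]
  have hpars : ∀ x y : V → ℝ, ∑ v, x v * y v = ∑ i, (∑ v, hA.eigenvectorBasis (e i) v * x v) *
      (∑ v, hA.eigenvectorBasis (e i) v * y v) := by
    intro x y
    calc ∑ v, x v * y v = ∑ v, ∑ i, (∑ v, hA.eigenvectorBasis (e i) v * x v) *
          (hA.eigenvectorBasis (e i) v * y v) := by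
          refine Finset.sum_congr rfl fun v _ => ?_
          conv_lhs => rw [hexp x v, Finset.sum_mul]
          exact Finset.sum_congr rfl fun i _ => by ring
      _ = _ := by
          rw [Finset.sum_comm]
          exact Finset.sum_congr rfl fun i _ => by rw [Finset.mul_sum]
  refine ⟨fun i v => hA.eigenvectorBasis (e i) v, hmul, horth, fun x => ?_, fun x => ?_⟩
  · have := hpars x x
    simp only [← sq] at this
    exact this
  · unfold adjForm
    rw [hpars]
    refine Finset.sum_congr rfl fun i _ => ?_
    rw [hsym]
    ring

lemma adjEigenvalues_antitone : Antitone (adjEigenvalues G) := by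
  classical
  unfold adjEigenvalues
  exact Matrix.IsHermitian.eigenvalues₀_antitone _

lemma adjSum_comb (x y : V → ℝ) (a b : ℝ) (v : V) :
    adjSum G (fun w => a * x w + b * y w) v = a * adjSum G x v + b * adjSum G y v := by
  unfold adjSum
  rw [Finset.sum_add_distrib, Finset.mul_sum, Finset.mul_sum]

lemma sum_mul_adjSum_comm (x y : V → ℝ) :
    ∑ v, x v * adjSum G y v = ∑ v, y v * adjSum G x v := by
  classical
  unfold adjSum
  simp_rw [Finset.mul_sum, SimpleGraph.neighborFinset_eq_filter, Finset.sum_filter]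
  rw [Finset.sum_comm]
  refine Finset.sum_congr rfl fun v _ => Finset.sum_congr rfl fun w _ => ?_
  simp only [G.adj_comm v w]
  split_ifs <;> ring

lemma adjForm_comb (x y : V → ℝ) (a b : ℝ) :
    adjForm G (fun w => a * x w + b * y w)
      = a ^ 2 * adjForm G x + 2 * (a * b) * ∑ v, x v * adjSum G y v + b ^ 2 * adjForm G y := by
  have h := sum_mul_adjSum_comm G x y
  have : adjForm G (fun w => a * x w + b * y w) = a ^ 2 * adjForm G x
      + a * b * (∑ v, x v * adjSum G y v) + a * b * (∑ v, y v * adjSum G x v)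
      + b ^ 2 * adjForm G y := by
    unfold adjForm
    simp only [adjSum_comb, Finset.mul_sum]
    rw [← Finset.sum_add_distrib, ← Finset.sum_add_distrib, ← Finset.sum_add_distrib]
    exact Finset.sum_congr rfl fun v _ => by ring
  rw [this, ← h]
  ring

lemma sum_sq_pos_of_ne {x : V → ℝ} {v : V} (h : x v ≠ 0) : 0 < ∑ v, x v ^ 2 :=
  lt_of_lt_of_le (by positivity)
    (Finset.single_le_sum (fun w _ => sq_nonneg (x w)) (Finset.mem_univ v))

lemma le_adjEigenvalues_zero (h : 0 < Fintype.card V) {x : V → ℝ} {μ : ℝ}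
    (hx : 0 < ∑ v, x v ^ 2) (hq : μ * ∑ v, x v ^ 2 ≤ adjForm G x) :
    μ ≤ adjEigenvalues G ⟨0, h⟩ := by
  obtain ⟨b, -, -, hn, hf⟩ := exists_eigenbasis G
  have : adjForm G x ≤ adjEigenvalues G ⟨0, h⟩ * ∑ v, x v ^ 2 := by
    rw [hf, hn, Finset.mul_sum]
    exact Finset.sum_le_sum fun i _ => mul_le_mul_of_nonneg_right
      (adjEigenvalues_antitone G (Fin.mk_le_of_le_val (Nat.zero_le _))) (sq_nonneg _)
  exact le_of_mul_le_mul_right (hq.trans this) hx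

/-- The Courant-Fischer lower bound for the second largest eigenvalue. -/
lemma le_adjEigenvalues_one (h : 1 < Fintype.card V) {x y : V → ℝ} {μ : ℝ}
    (hpos : ∀ a b : ℝ, (a ≠ 0 ∨ b ≠ 0) → 0 < ∑ v, (a * x v + b * y v) ^ 2)
    (hq : ∀ a b : ℝ, μ * ∑ v, (a * x v + b * y v) ^ 2
      ≤ adjForm G (fun v => a * x v + b * y v)) :
    μ ≤ adjEigenvalues G ⟨1, h⟩ := by
  obtain ⟨e, -, -, hn, hf⟩ := exists_eigenbasis G
  set i0 : Fin (Fintype.card V) := ⟨0, by omega⟩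
  -- The span of `x` and `y` contains a nonzero combination orthogonal to the top eigenvector.
  obtain ⟨a, b, hab, h0⟩ : ∃ a b : ℝ, (a ≠ 0 ∨ b ≠ 0) ∧
      ∑ v, e i0 v * (a * x v + b * y v) = 0 := by
    have hlin : ∀ a b : ℝ, ∑ v, e i0 v * (a * x v + b * y v)
        = a * (∑ v, e i0 v * x v) + b * (∑ v, e i0 v * y v) := by
      intro a b
      rw [Finset.mul_sum, Finset.mul_sum, ← Finset.sum_add_distrib]
      exact Finset.sum_congr rfl fun v _ => by ring
    by_cases hx : ∑ v, e i0 v * x v = 0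
    · exact ⟨1, 0, Or.inl one_ne_zero, by rw [hlin, hx]; ring⟩
    · exact ⟨∑ v, e i0 v * y v, -∑ v, e i0 v * x v, Or.inr (neg_ne_zero.mpr hx),
        by rw [hlin]; ring⟩
  have hle : adjForm G (fun v => a * x v + b * y v)
      ≤ adjEigenvalues G ⟨1, h⟩ * ∑ v, (a * x v + b * y v) ^ 2 := by
    rw [hf, hn, Finset.mul_sum]
    refine Finset.sum_le_sum fun i _ => ?_
    by_cases hi : i = i0
    · subst hi
      simp [h0]
    · refine mul_le_mul_of_nonneg_right (adjEigenvalues_antitone G ?_) (sq_nonneg _)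
      rw [Fin.le_def]
      have : (i : ℕ) ≠ 0 := fun hc => hi (Fin.ext hc)
      simp
      omega
  exact le_of_mul_le_mul_right ((hq a b).trans hle) (hpos a b hab)

/-- The Ky Fan inequality for two orthogonal vectors. -/
lemma add_le_adjEigenvalues_add (h : 1 < Fintype.card V) {x y : V → ℝ} {μ ν : ℝ}
    (hx : 0 < ∑ v, x v ^ 2) (hy : 0 < ∑ v, y v ^ 2) (hxy : ∑ v, x v * y v = 0)
    (hqx : μ * ∑ v, x v ^ 2 ≤ adjForm G x) (hqy : ν * ∑ v, y v ^ 2 ≤ adjForm G y) :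
    μ + ν ≤ adjEigenvalues G ⟨0, by omega⟩ + adjEigenvalues G ⟨1, h⟩ := by
  obtain ⟨e, -, horth, hn, hf⟩ := exists_eigenbasis G
  set i0 : Fin (Fintype.card V) := ⟨0, by omega⟩
  set i1 : Fin (Fintype.card V) := ⟨1, h⟩
  set X := ∑ v, x v ^ 2 with hX
  set Y := ∑ v, y v ^ 2 with hY
  set c : Fin (Fintype.card V) → ℝ := fun i => ∑ v, e i v * x v with hc
  set d : Fin (Fintype.card V) → ℝ := fun i => ∑ v, e i v * y v with hd
  have hμ : μ ≤ ∑ i, adjEigenvalues G i * (c i ^ 2 / X) := by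
    rw [← mul_le_mul_iff_left₀ hx, Finset.sum_mul]
    refine hqx.trans_eq ?_
    rw [hf]
    exact Finset.sum_congr rfl fun i _ => by field_simp [hx.ne']; rfl
  have hν : ν ≤ ∑ i, adjEigenvalues G i * (d i ^ 2 / Y) := by
    rw [← mul_le_mul_iff_left₀ hy, Finset.sum_mul]
    refine hqy.trans_eq ?_
    rw [hf]
    exact Finset.sum_congr rfl fun i _ => by field_simp [hy.ne']; rfl
  -- The two Rayleigh quotients add up to a weighted sum of eigenvalues with total weight 2.
  -- Bessel's inequality caps the weight of the top one at 1, and the rest is worth at most the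
  -- second eigenvalue.
  have hw : ∑ i, (c i ^ 2 / X + d i ^ 2 / Y) = 2 := by
    rw [Finset.sum_add_distrib, ← Finset.sum_div, ← Finset.sum_div, ← hn, ← hn, ← hX, ← hY,
      div_self hx.ne', div_self hy.ne']
    norm_num
  have hb : c i0 ^ 2 / X + d i0 ^ 2 / Y ≤ 1 := by
    have h1 : 0 ≤ ∑ v, (e i0 v - (c i0 / X) * x v - (d i0 / Y) * y v) ^ 2 :=
      Finset.sum_nonneg fun v _ => sq_nonneg _
    have h2 : ∑ v, (e i0 v - (c i0 / X) * x v - (d i0 / Y) * y v) ^ 2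
        = (∑ v, e i0 v * e i0 v) + (c i0 / X) ^ 2 * X + (d i0 / Y) ^ 2 * Y
          - 2 * (c i0 / X) * c i0 - 2 * (d i0 / Y) * d i0
          + 2 * (c i0 / X) * (d i0 / Y) * ∑ v, x v * y v := by
      simp only [hc, hd, hX, hY, Finset.mul_sum, ← Finset.sum_add_distrib,
        ← Finset.sum_sub_distrib]
      exact Finset.sum_congr rfl fun v _ => by ring
    rw [h2, horth, hxy] at h1
    simp only [if_true, mul_zero, add_zero] at h1
    have e1 : (c i0 / X) ^ 2 * X = c i0 ^ 2 / X := by field_simp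
    have e2 : (d i0 / Y) ^ 2 * Y = d i0 ^ 2 / Y := by field_simp
    have e3 : 2 * (c i0 / X) * c i0 = 2 * (c i0 ^ 2 / X) := by ring
    have e4 : 2 * (d i0 / Y) * d i0 = 2 * (d i0 ^ 2 / Y) := by ring
    rw [e1, e2, e3, e4] at h1
    linarith
  have hanti := adjEigenvalues_antitone G
  have h01 : adjEigenvalues G i1 ≤ adjEigenvalues G i0 := hanti (by simp [i0, i1, Fin.le_def])
  have key : ∑ i, (adjEigenvalues G i - adjEigenvalues G i1) * (c i ^ 2 / X + d i ^ 2 / Y)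
      ≤ adjEigenvalues G i0 - adjEigenvalues G i1 := by
    calc _ ≤ ∑ i, if i = i0 then adjEigenvalues G i0 - adjEigenvalues G i1 else 0 := by
          refine Finset.sum_le_sum fun i _ => ?_
          split_ifs with hi
          · subst hi
            nlinarith
          · refine mul_nonpos_of_nonpos_of_nonneg (sub_nonpos.mpr (hanti ?_)) (by positivity)
            rw [Fin.le_def]
            have : (i : ℕ) ≠ 0 := fun hc => hi (Fin.ext hc)
            simp [i1]
            omega
      _ = _ := by simp
  have key2 : ∑ i, (adjEigenvalues G i - adjEigenvalues G i1) * (c i ^ 2 / X + d i ^ 2 / Y)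
      = (∑ i, adjEigenvalues G i * (c i ^ 2 / X)) + (∑ i, adjEigenvalues G i * (d i ^ 2 / Y))
        - 2 * adjEigenvalues G i1 := by
    rw [← hw, Finset.sum_mul, ← Finset.sum_add_distrib, ← Finset.sum_sub_distrib]
    exact Finset.sum_congr rfl fun i _ => by ring
  rw [key2] at key
  linarith

lemma adjEigenvalues_zero_le (h : 0 < Fintype.card V) {M : ℝ}
    (hM : ∀ x : V → ℝ, adjForm G x ≤ M * ∑ v, x v ^ 2) : adjEigenvalues G ⟨0, h⟩ ≤ M := by
  obtain ⟨e, he, horth, -, -⟩ := exists_eigenbasis G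
  have h1 : ∑ v, e ⟨0, h⟩ v ^ 2 = 1 := by simpa [sq] using horth ⟨0, h⟩ ⟨0, h⟩
  have h2 : adjForm G (e ⟨0, h⟩) = adjEigenvalues G ⟨0, h⟩ := by
    unfold adjForm
    rw [he]
    calc ∑ v, e ⟨0, h⟩ v * (adjEigenvalues G ⟨0, h⟩ • e ⟨0, h⟩) v
        = adjEigenvalues G ⟨0, h⟩ * ∑ v, e ⟨0, h⟩ v ^ 2 := by
          rw [Finset.mul_sum]
          exact Finset.sum_congr rfl fun v _ => by simp; ring
      _ = _ := by rw [h1, mul_one]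
  have := hM (e ⟨0, h⟩)
  rwa [h1, h2, mul_one] at this

/-- If the adjacency form is nonpositive on the weightings vanishing at some vertex, then the
second largest eigenvalue is nonpositive. -/
lemma adjEigenvalues_one_nonpos (h : 1 < Fintype.card V) (z : V)
    (hM : ∀ x : V → ℝ, x z = 0 → adjForm G x ≤ 0) : adjEigenvalues G ⟨1, h⟩ ≤ 0 := by
  obtain ⟨e, he, horth, hn, hf⟩ := exists_eigenbasis G
  set i0 : Fin (Fintype.card V) := ⟨0, by omega⟩
  set i1 : Fin (Fintype.card V) := ⟨1, h⟩
  have hne : i0 ≠ i1 := by simp [i0, i1]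
  have h01 : adjEigenvalues G i1 ≤ adjEigenvalues G i0 :=
    adjEigenvalues_antitone G (by simp [i0, i1, Fin.le_def])
  -- Some nonzero combination of the top two eigenvectors vanishes at `z`; its form would be
  -- positive if the second eigenvalue were.
  obtain ⟨a, b, hab, h0⟩ : ∃ a b : ℝ, 0 < a ^ 2 + b ^ 2 ∧ a * e i0 z + b * e i1 z = 0 := by
    by_cases hx : e i0 z = 0
    · exact ⟨1, 0, by norm_num, by simp [hx]⟩
    · exact ⟨e i1 z, -e i0 z, by
        have := pow_pos (abs_pos.mpr hx) 2
        rw [sq_abs] at this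
        nlinarith [sq_nonneg (e i1 z)], by ring⟩
  have hform : adjForm G (fun v => a * e i0 v + b * e i1 v)
      = adjEigenvalues G i0 * a ^ 2 + adjEigenvalues G i1 * b ^ 2 := by
    have hco : ∀ i, ∑ v, e i v * (a * e i0 v + b * e i1 v)
        = (if i = i0 then a else 0) + (if i = i1 then b else 0) := by
      intro i
      have : ∑ v, e i v * (a * e i0 v + b * e i1 v)
          = a * (∑ v, e i v * e i0 v) + b * (∑ v, e i v * e i1 v) := by
        rw [Finset.mul_sum, Finset.mul_sum, ← Finset.sum_add_distrib]
        exact Finset.sum_congr rfl fun v _ => by ring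
      rw [this, horth, horth]
      simp
    rw [hf, Finset.sum_eq_add_of_mem i0 i1 (Finset.mem_univ _) (Finset.mem_univ _) hne]
    · simp [hco, hne, hne.symm]
    · rintro i - ⟨h1, h2⟩
      simp [hco, h1, h2]
  have := hM (fun v => a * e i0 v + b * e i1 v) h0
  rw [hform] at this
  by_contra hc
  push Not at hc
  have hc0 : 0 < adjEigenvalues G i0 := lt_of_lt_of_le hc h01
  have hc1 : 0 < adjEigenvalues G i1 := hc
  nlinarith [sq_nonneg a, sq_nonneg b, mul_nonneg (sub_nonneg.mpr h01) (sq_nonneg a)]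

end Spectral

/-! ### Characteristic polynomials of paths and their ratios -/

section Sequence

/-- The characteristic polynomial of the path on `k - 1` vertices, evaluated at `L`. -/
def pathSeq (L : ℝ) : ℕ → ℝ
  | 0 => 0
  | 1 => 1
  | k + 2 => L * pathSeq L (k + 1) - pathSeq L k

/-- The ratio of consecutive terms of `pathSeq`, that is, the diagonal entry at an end vertex of
the resolvent at `L` of the path on `k` vertices. -/
noncomputable def pathRatio (L : ℝ) (k : ℕ) : ℝ := pathSeq L k / pathSeq L (k + 1)

variable {L : ℝ}

lemma pathSeq_one : pathSeq L 1 = 1 := rfl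

lemma pathSeq_add_two (k : ℕ) : pathSeq L (k + 2) = L * pathSeq L (k + 1) - pathSeq L k := rfl

lemma pathRatio_zero : pathRatio L 0 = 0 := by simp [pathRatio, pathSeq]

/-- Deleting an edge splits the path on `a + b` vertices into paths on `a` and `b` vertices; this is
the resulting expansion of its characteristic polynomial. -/
lemma pathSeq_add_add_one (a b : ℕ) :
    pathSeq L (a + b + 1) = pathSeq L (a + 1) * pathSeq L (b + 1) - pathSeq L a * pathSeq L b := by
  induction b using Nat.twoStepInduction with
  | zero => simp [pathSeq]
  | one => simp only [pathSeq]; ring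
  | more b h1 h2 =>
    have e1 : pathSeq L (a + (b + 2) + 1)
        = L * pathSeq L (a + (b + 1) + 1) - pathSeq L (a + b + 1) := rfl
    rw [e1, h1, h2, pathSeq_add_two (b + 1), pathSeq_add_two b]
    ring

/-- The analogue of an addition formula for sines; it evaluates all differences of `pathRatio`. -/
lemma pathSeq_add_mul_sub (a b : ℕ) :
    pathSeq L (a + b) * pathSeq L (a + 1) - pathSeq L a * pathSeq L (a + b + 1)
      = pathSeq L b := by
  induction a with
  | zero => simp [pathSeq]
  | succ a ih =>
    have e1 : pathSeq L (a + 1 + b + 1) = L * pathSeq L (a + b + 1) - pathSeq L (a + b) := by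
      rw [show a + 1 + b + 1 = a + b + 2 by ring, pathSeq_add_two]
    rw [e1, pathSeq_add_two, show a + 1 + b = a + b + 1 by ring, ← ih]
    ring

/-- Positivity of the first `m` terms of `pathSeq L`. -/
def PathPos (L : ℝ) (m : ℕ) : Prop := ∀ k, 1 ≤ k → k ≤ m → 0 < pathSeq L k

lemma PathPos.mono {m k : ℕ} (h : PathPos L m) (hk : k ≤ m) : PathPos L k :=
  fun j h1 h2 => h j h1 (h2.trans hk)

lemma PathPos.nonneg {m k : ℕ} (h : PathPos L m) (hk : k ≤ m) : 0 ≤ pathSeq L k := by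
  rcases Nat.eq_zero_or_pos k with rfl | h0
  · exact le_rfl
  · exact (h k h0 hk).le

lemma PathPos.ratio_nonneg {m k : ℕ} (h : PathPos L m) (hk : k + 1 ≤ m) : 0 ≤ pathRatio L k :=
  div_nonneg (h.nonneg (by omega)) (h.nonneg hk)

lemma pathRatio_add_sub {a b : ℕ} (ha : pathSeq L (a + 1) ≠ 0)
    (hab : pathSeq L (a + b + 1) ≠ 0) :
    pathRatio L (a + b) - pathRatio L a
      = pathSeq L b / (pathSeq L (a + 1) * pathSeq L (a + b + 1)) := by
  rw [← pathSeq_add_mul_sub a b, pathRatio, pathRatio]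
  field_simp

lemma PathPos.ratio_mono {a b m : ℕ} (h : PathPos L m) (hab : a ≤ b) (hb : b + 1 ≤ m) :
    pathRatio L a ≤ pathRatio L b := by
  obtain ⟨d, rfl⟩ := Nat.exists_eq_add_of_le hab
  have h1 := h (a + 1) (by omega) (by omega)
  have h2 := h (a + d + 1) (by omega) (by omega)
  have h3 := h.nonneg (k := d) (by omega)
  have := pathRatio_add_sub h1.ne' h2.ne'
  have : 0 ≤ pathSeq L d / (pathSeq L (a + 1) * pathSeq L (a + d + 1)) := by positivity
  linarith

/-- The last factor is the Schur complement at the vertex joining paths on `a` and `b` vertices. -/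
lemma pathSeq_merge {a b : ℕ} (ha : pathSeq L (a + 1) ≠ 0) (hb : pathSeq L (b + 1) ≠ 0) :
    pathSeq L (a + b + 2)
      = pathSeq L (a + 1) * pathSeq L (b + 1) * (L - pathRatio L a - pathRatio L b) := by
  rw [show a + b + 2 = a + (b + 1) + 1 by ring, pathSeq_add_add_one, pathSeq_add_two, pathRatio,
    pathRatio]
  field_simp
  ring

/-- Joining two paths at a new vertex does not increase the resolvent entry. -/
lemma PathPos.merge {a b : ℕ} (ha : PathPos L (a + 1)) (hb : PathPos L (b + 1))
    (h : pathRatio L a + pathRatio L b < L) :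
    PathPos L (a + b + 2) ∧ pathRatio L (a + b) ≤ pathRatio L a + pathRatio L b := by
  have hpos : PathPos L (a + b + 2) := by
    intro k h1 h2
    rcases le_or_gt k (a + 1) with hk | hk
    · exact ha k h1 hk
    · obtain ⟨d, rfl⟩ := Nat.exists_eq_add_of_le (show a + 2 ≤ k from hk)
      have hd : d ≤ b := by omega
      have p1 := ha (a + 1) (by omega) le_rfl
      have p2 := hb (d + 1) (by omega) (by omega)
      rw [show a + 2 + d = a + d + 2 by ring, pathSeq_merge p1.ne' p2.ne']
      have := hb.ratio_mono hd le_rfl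
      exact mul_pos (mul_pos p1 p2) (by linarith)
  refine ⟨hpos, ?_⟩
  have p1 := hpos (a + 1) (by omega) (by omega)
  have p2 := hpos (a + b + 1) (by omega) (by omega)
  have p3 := hb (b + 1) (by omega) le_rfl
  have p4 := hpos (a + b + 2) (by omega) (by omega)
  have p5 := ha.nonneg (k := a) (by omega)
  have p6 := hb.nonneg (k := b) (by omega)
  have h1 := pathRatio_add_sub p1.ne' p2.ne'
  have h2 := pathSeq_add_mul_sub (L := L) a (b + 1)
  rw [← add_assoc] at h2
  -- By `h2` the denominator exceeds `pathSeq L (b + 1)` by `pathSeq L a * pathSeq L (a + b + 2)`,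
  -- which is nonnegative.
  have h3 : pathSeq L b / (pathSeq L (a + 1) * pathSeq L (a + b + 1)) ≤ pathRatio L b := by
    unfold pathRatio
    refine div_le_div_of_nonneg_left p6 p3 ?_
    nlinarith [mul_nonneg p5 p4.le]
  linarith

lemma PathPos.merge_sum {ι : Type*} (W : Finset ι) (c : ι → ℕ)
    (hpos : ∀ w ∈ W, PathPos L (c w + 1)) (h : ∑ w ∈ W, pathRatio L (c w) < L) :
    PathPos L (∑ w ∈ W, c w + 2) ∧
      pathRatio L (∑ w ∈ W, c w) ≤ ∑ w ∈ W, pathRatio L (c w) := by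
  classical
  induction W using Finset.induction_on with
  | empty =>
    simp only [Finset.sum_empty] at h ⊢
    refine ⟨fun k h1 h2 => ?_, pathRatio_zero.le⟩
    obtain rfl | rfl : k = 1 ∨ k = 2 := by omega
    · simp [pathSeq]
    · simpa [pathSeq] using h
  | insert w W hw ih =>
    rw [Finset.sum_insert hw] at h
    rw [Finset.sum_insert hw, Finset.sum_insert hw]
    have hcw := hpos w (Finset.mem_insert_self _ _)
    have h0 : 0 ≤ pathRatio L (c w) := hcw.ratio_nonneg le_rfl
    obtain ⟨i1, i2⟩ := ih (fun y hy => hpos y (Finset.mem_insert_of_mem hy)) (by linarith)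
    obtain ⟨j1, j2⟩ := hcw.merge (i1.mono (Nat.le_succ _)) (by linarith)
    exact ⟨j1, by linarith⟩

/-- From level 2 on the terms grow by at least 1 at each step, so the ratio lemmas hold without
index bounds. This is why the numerical criteria use only levels `L ≥ 2`. -/
lemma pathPos_of_two_le (hL : 2 ≤ L) (m : ℕ) : PathPos L m := by
  have key : ∀ k : ℕ, 0 ≤ pathSeq L k ∧ pathSeq L k + 1 ≤ pathSeq L (k + 1) := by
    intro k
    induction k with
    | zero => simp [pathSeq]
    | succ k ih =>
      refine ⟨by linarith [ih.1, ih.2], ?_⟩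
      rw [pathSeq_add_two]
      nlinarith [ih.1, ih.2]
  intro k h1 _
  obtain ⟨j, rfl⟩ := Nat.exists_eq_add_of_le' h1
  linarith [(key j).1, (key j).2]

lemma pathRatio_mono (hL : 2 ≤ L) : Monotone (pathRatio L) := fun _ b hab =>
  (pathPos_of_two_le hL (b + 1)).ratio_mono hab le_rfl

lemma pathRatio_succ (hL : 2 ≤ L) (k : ℕ) : pathRatio L (k + 1) = 1 / (L - pathRatio L k) := by
  have h1 := pathPos_of_two_le hL (k + 1) (k + 1) (by omega) le_rfl
  have h2 := pathPos_of_two_le hL (k + 2) (k + 2) (by omega) le_rfl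
  rw [pathSeq_add_two] at h2
  rw [pathRatio, pathRatio, pathSeq_add_two, eq_div_iff, div_mul_eq_mul_div, div_eq_one_iff_eq h2.ne']
  · field_simp
  · rw [sub_ne_zero, ne_eq, eq_div_iff h1.ne']
    linarith

end Sequence

/-! ### Branches of a tree, defined by distances -/

section Branches

variable {V : Type*} [Fintype V] {G : SimpleGraph V}

open Classical in
/-- For adjacent vertices `u`, `w` of a tree, the component containing `w` after removal of `u`. -/
noncomputable def branch (G : SimpleGraph V) (u w : V) : Finset V :=
  Finset.univ.filter fun x => G.dist x w < G.dist x u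

lemma mem_branch {u w x : V} : x ∈ branch G u w ↔ G.dist x w < G.dist x u := by
  simp [branch]

lemma self_mem_branch {u w : V} (h : G.Adj u w) : w ∈ branch G u w := by
  rw [mem_branch, SimpleGraph.dist_self, SimpleGraph.dist_comm, SimpleGraph.dist_eq_one_iff_adj.mpr h]
  exact one_pos

lemma notMem_branch {u w : V} : u ∉ branch G u w := by
  simp [mem_branch]

lemma exists_adj_mem_branch (hG : G.Connected) {v x : V} (hx : x ≠ v) :
    ∃ w, G.Adj v w ∧ x ∈ branch G v w := by
  obtain ⟨p, hp⟩ := hG.exists_walk_length_eq_dist v x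
  cases p with
  | nil => exact absurd rfl hx
  | cons h q =>
    rename_i w
    refine ⟨w, h, ?_⟩
    rw [mem_branch, SimpleGraph.dist_comm, SimpleGraph.dist_comm (u := x), ← hp]
    exact Nat.lt_of_le_of_lt (SimpleGraph.dist_le q) (by simp)

lemma branch_unique (hG : G.IsTree) {v w w' x : V} (hw : G.Adj v w) (hw' : G.Adj v w')
    (hx : x ∈ branch G v w) (hx' : x ∈ branch G v w') : w = w' := by
  have key : ∀ y, G.Adj v y → x ∈ branch G v y →
      ∃ p : G.Walk v x, p.IsPath ∧ p.snd = y := by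
    intro y hy hxy
    obtain ⟨q, hq⟩ := hG.connected.exists_walk_length_eq_dist y x
    refine ⟨q.cons hy, SimpleGraph.Walk.isPath_of_length_eq_dist _ ?_, by simp⟩
    rw [mem_branch] at hxy
    rw [SimpleGraph.Walk.length_cons, hq, SimpleGraph.dist_comm, SimpleGraph.dist_comm (u := v)]
    rcases hG.dist_eq_dist_add_one_of_adj x hy with h | h <;> omega
  obtain ⟨p, hp, rfl⟩ := key w hw hx
  obtain ⟨q, hq, rfl⟩ := key w' hw' hx'
  rw [(hG.existsUnique_path v x).unique hp hq]

lemma mem_branch_symm (hG : G.IsTree) {u w x : V} (h : G.Adj u w) :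
    x ∈ branch G w u ↔ x ∉ branch G u w := by
  rw [mem_branch, mem_branch]
  have := hG.dist_ne_of_adj x h
  omega

lemma branch_subset (hG : G.IsTree) {u w y : V} (h : G.Adj u w) (hy : G.Adj w y) (hyu : y ≠ u) :
    branch G w y ⊆ branch G u w := by
  intro x hx
  by_contra hc
  rw [← mem_branch_symm hG h] at hc
  exact hyu (branch_unique hG hy h.symm hx hc)

lemma eq_of_adj_of_mem_branch (hG : G.IsTree) {u w x y : V} (h : G.Adj u w) (hxy : G.Adj x y)
    (hx : x ∈ branch G u w) (hy : y ∉ branch G u w) : x = w ∧ y = u := by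
  have h1 := hG.dist_eq_dist_add_one_of_adj x h
  have h2 := hG.dist_eq_dist_add_one_of_adj y h
  have h3 := hG.dist_eq_dist_add_one_of_adj u hxy
  have h4 := hG.dist_eq_dist_add_one_of_adj w hxy
  rw [mem_branch] at hx hy
  rw [SimpleGraph.dist_comm (u := u), SimpleGraph.dist_comm (u := u)] at h3
  rw [SimpleGraph.dist_comm (u := w), SimpleGraph.dist_comm (u := w)] at h4
  by_cases hxw : x = w
  · subst hxw
    refine ⟨rfl, ?_⟩
    rw [SimpleGraph.dist_self] at *
    have : G.dist y u = 0 := by omega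
    exact (hG.connected.dist_eq_zero_iff).mp this
  · exfalso
    -- Step from `x` to `z` towards `w`. Both `z` and `y` would be the neighbour of `x` in the
    -- direction of `u`, hence equal, but they lie on different sides of the edge.
    obtain ⟨z, hz, hwz⟩ := exists_adj_mem_branch hG.connected (v := x) (x := w) (Ne.symm hxw)
    rw [mem_branch, SimpleGraph.dist_comm, SimpleGraph.dist_comm (u := w)] at hwz
    have hzu : G.dist z u ≤ G.dist z w + 1 := by
      rw [← SimpleGraph.dist_eq_one_iff_adj.mpr h.symm]
      exact hG.connected.dist_triangle
    have : z = y := by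
      refine branch_unique hG (x := u) hz hxy ?_ ?_ <;>
      · rw [mem_branch, SimpleGraph.dist_comm, SimpleGraph.dist_comm (u := u)]
        omega
    subst this
    omega

lemma card_branch (hG : G.IsTree) [DecidableEq V] [DecidableRel G.Adj] {u w : V}
    (h : G.Adj u w) :
    (branch G u w).card = 1 + ∑ y ∈ (G.neighborFinset w).erase u, (branch G w y).card := by
  have : branch G u w = insert w (((G.neighborFinset w).erase u).biUnion (branch G w)) := by
    ext x
    simp only [Finset.mem_insert, Finset.mem_biUnion, Finset.mem_erase,
      SimpleGraph.mem_neighborFinset]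
    constructor
    · intro hx
      by_cases hxw : x = w
      · exact Or.inl hxw
      · obtain ⟨y, hy, hxy⟩ := exists_adj_mem_branch hG.connected hxw
        refine Or.inr ⟨y, ⟨?_, hy⟩, hxy⟩
        rintro rfl
        exact (mem_branch_symm hG h).mp hxy hx
    · rintro (rfl | ⟨y, ⟨hyu, hy⟩, hxy⟩)
      · exact self_mem_branch h
      · exact branch_subset hG h hy hyu hxy
  rw [this, Finset.card_insert_of_notMem, Finset.card_biUnion, add_comm]
  · intro y hy y' hy' hne
    rw [Function.onFun, Finset.disjoint_left]
    intro x hx hx'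
    simp only [Finset.mem_coe, Finset.mem_erase, SimpleGraph.mem_neighborFinset] at hy hy'
    exact hne (branch_unique hG hy.2 hy'.2 hx hx')
  · simp only [Finset.mem_biUnion, not_exists, not_and]
    intro y _
    exact notMem_branch

lemma card_eq_one_add_sum_branch (hG : G.IsTree) [DecidableRel G.Adj] (v : V) :
    Fintype.card V = 1 + ∑ w ∈ G.neighborFinset v, (branch G v w).card := by
  classical
  have : (Finset.univ : Finset V) = insert v ((G.neighborFinset v).biUnion (branch G v)) := by
    ext x
    simp only [Finset.mem_insert, Finset.mem_biUnion, SimpleGraph.mem_neighborFinset,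
      Finset.mem_univ, true_iff]
    by_cases hxv : x = v
    · exact Or.inl hxv
    · exact Or.inr (exists_adj_mem_branch hG.connected hxv)
  rw [← Finset.card_univ, this, Finset.card_insert_of_notMem, Finset.card_biUnion, add_comm]
  · intro y hy y' hy' hne
    rw [Function.onFun, Finset.disjoint_left]
    intro x hx hx'
    simp only [Finset.mem_coe, SimpleGraph.mem_neighborFinset] at hy hy'
    exact hne (branch_unique hG hy hy' hx hx')
  · simp only [Finset.mem_biUnion, not_exists, not_and]
    intro y _
    exact notMem_branch

lemma card_branch_add_card_branch (hG : G.IsTree) {u w : V} (h : G.Adj u w) :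
    (branch G w u).card + (branch G u w).card = Fintype.card V := by
  classical
  have : branch G w u = (branch G u w)ᶜ := by
    ext x
    rw [mem_branch_symm hG h, Finset.mem_compl]
  rw [this, Finset.card_compl_add_card]

end Branches

/-! ### Positive supersolutions and comparison of branches with paths -/

section Resolvent

variable {V : Type*} [Fintype V] {G : SimpleGraph V}

/-- The adjacency form, lowered by the diagonal weights `δ`, attains at least `L` times the squared
norm at a nonzero weighting supported on `C`. -/
def FormBound (G : SimpleGraph V) (C : Finset V) (δ : V → ℝ) (L : ℝ) : Prop :=
  ∃ x : V → ℝ, (∀ z ∉ C, x z = 0) ∧ 0 < ∑ z, x z ^ 2 ∧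
    L * ∑ z, x z ^ 2 ≤ adjForm G x - ∑ z, δ z * x z ^ 2

lemma adjSum_nonneg {x : V → ℝ} (h : ∀ z, 0 ≤ x z) (v : V) : 0 ≤ adjSum G x v :=
  Finset.sum_nonneg fun w _ => h w

/-- If the form of `L + δ - A` is positive definite on the weightings supported on `C`, then
there is a strict supersolution which is positive on `C`. -/
lemma formBound_or_exists_supersolution (C : Finset V) (δ : V → ℝ) (L : ℝ) :
    FormBound G C δ L ∨ ∃ x : V → ℝ, (∀ z ∉ C, x z = 0) ∧ (∀ z ∈ C, 0 < x z) ∧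
      ∀ z ∈ C, adjSum G x z < (L + δ z) * x z := by
  classical
  rw [or_iff_not_imp_left]
  intro hnot
  have hdef : ∀ x : V → ℝ, (∀ z ∉ C, x z = 0) →
      adjForm G x ≥ ∑ z, (L + δ z) * x z ^ 2 → ∀ z, x z = 0 := by
    intro x hx hle z
    by_contra hz
    refine hnot ⟨x, hx, sum_sq_pos_of_ne hz, ?_⟩
    simp only [add_mul, Finset.sum_add_distrib, ← Finset.mul_sum] at hle
    linarith
  let res : (V → ℝ) → V → ℝ := fun x z => if z ∈ C then x z else 0
  -- `L + δ - A` compressed to `C`, completed by the identity off `C` so that it acts on the whole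
  -- space; definiteness makes it injective, so the right-hand side `1` on `C` is attained.
  let Φ : (V → ℝ) →ₗ[ℝ] (V → ℝ) :=
    { toFun := fun x z => if z ∈ C then (L + δ z) * x z - adjSum G (res x) z else x z
      map_add' := by
        intro x y
        funext z
        have : adjSum G (res (x + y)) z = adjSum G (res x) z + adjSum G (res y) z := by
          simp only [adjSum, ← Finset.sum_add_distrib]
          refine Finset.sum_congr rfl fun w _ => ?_
          simp only [res, Pi.add_apply]
          split_ifs <;> simp
        simp only [this, Pi.add_apply]
        split_ifs <;> ring
      map_smul' := by
        intro c x
        funext z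
        have : adjSum G (res (c • x)) z = c * adjSum G (res x) z := by
          simp only [adjSum, Finset.mul_sum]
          refine Finset.sum_congr rfl fun w _ => ?_
          simp only [res, Pi.smul_apply, smul_eq_mul]
          split_ifs <;> simp
        simp only [this, Pi.smul_apply, smul_eq_mul, RingHom.id_apply]
        split_ifs <;> ring }
  have hΦ : ∀ x z, Φ x z = if z ∈ C then (L + δ z) * x z - adjSum G (res x) z else x z :=
    fun _ _ => rfl
  have hres : ∀ x : V → ℝ, (∀ z ∉ C, x z = 0) → res x = x := by
    intro x hx
    funext z
    simp only [res]
    split_ifs with h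
    · rfl
    · exact (hx z h).symm
  have hinj : Function.Injective Φ := by
    rw [← LinearMap.ker_eq_bot, LinearMap.ker_eq_bot']
    intro x hx
    have h0 : ∀ z ∉ C, x z = 0 := by
      intro z hz
      have := congrFun hx z
      rwa [hΦ, if_neg hz] at this
    refine funext (hdef x h0 (ge_of_eq ?_))
    unfold adjForm
    refine Finset.sum_congr rfl fun z _ => ?_
    by_cases hz : z ∈ C
    · have := congrFun hx z
      rw [hΦ, if_pos hz, hres x h0] at this
      have : adjSum G x z = (L + δ z) * x z := by
        simp only [Pi.zero_apply] at this
        linarith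
      rw [this]
      ring
    · rw [h0 z hz]
      ring
  obtain ⟨x, hx⟩ := (LinearMap.injective_iff_surjective.mp hinj) fun z => if z ∈ C then 1 else 0
  have h0 : ∀ z ∉ C, x z = 0 := by
    intro z hz
    have := congrFun hx z
    rwa [hΦ, if_neg hz, if_neg hz] at this
  have h1 : ∀ z ∈ C, (L + δ z) * x z - adjSum G x z = 1 := by
    intro z hz
    have := congrFun hx z
    rwa [hΦ, if_pos hz, if_pos hz, hres x h0] at this
  have hnn : ∀ z, 0 ≤ x z := by
    -- The negative part of the solution satisfies the inequality excluded by definiteness, so it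
    -- vanishes.
    let y : V → ℝ := fun z => max (-x z) 0
    have hy0 : ∀ z ∉ C, y z = 0 := fun z hz => by simp [y, h0 z hz]
    have hy : ∀ z, y z = 0 := by
      refine hdef y hy0 ?_
      unfold adjForm
      refine Finset.sum_le_sum fun z _ => ?_
      rcases le_or_gt 0 (x z) with h | h
      · have : y z = 0 := by simp [y, h]
        rw [this]
        simp
      · have hyz : y z = -x z := by simp only [y]; exact max_eq_left (by linarith)
        have hz : z ∈ C := by
          by_contra hz
          exact h.ne (h0 z hz)
        have hs : -adjSum G x z ≤ adjSum G y z := by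
          unfold adjSum
          rw [← Finset.sum_neg_distrib]
          exact Finset.sum_le_sum fun w _ => le_max_left _ _
        have := h1 z hz
        rw [hyz]
        nlinarith
    intro z
    have := hy z
    simp only [y] at this
    have := le_max_left (-x z) 0
    linarith
  refine ⟨x, h0, fun z hz => ?_, fun z hz => by linarith [h1 z hz]⟩
  rcases (hnn z).lt_or_eq with h | h
  · exact h
  · exfalso
    have h2 := h1 z hz
    have h3 := adjSum_nonneg (G := G) hnn z
    rw [← h] at h2
    linarith

/-- Along a branch of a tree, a positive supersolution decays at most as fast as along a path with
the same number of vertices. -/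
lemma pathRatio_card_branch_le (hG : G.IsTree) {L : ℝ} {x : V → ℝ} {u w : V} (h : G.Adj u w)
    (hu : 0 < x u) (hpos : ∀ z ∈ branch G u w, 0 < x z)
    (hsup : ∀ z ∈ branch G u w, adjSum G x z ≤ L * x z) :
    PathPos L ((branch G u w).card + 1) ∧
      pathRatio L (branch G u w).card * x u ≤ x w := by
  classical
  induction hn : (branch G u w).card using Nat.strong_induction_on generalizing u w with
  | _ n ih =>
    subst hn
    set W := (G.neighborFinset w).erase u with hW
    have hw : 0 < x w := hpos w (self_mem_branch h)
    have hcard : (branch G u w).card = ∑ y ∈ W, (branch G w y).card + 1 := by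
      rw [card_branch hG h, add_comm]
    have hch : ∀ y ∈ W, PathPos L ((branch G w y).card + 1) ∧
        pathRatio L (branch G w y).card * x w ≤ x y := by
      intro y hy
      have hy' := hy
      rw [hW, Finset.mem_erase, SimpleGraph.mem_neighborFinset] at hy'
      have hsub := branch_subset hG h hy'.2 hy'.1
      refine ih _ ?_ hy'.2 hw (fun z hz => hpos z (hsub hz)) (fun z hz => hsup z (hsub hz)) rfl
      rw [hcard, Nat.lt_succ_iff]
      exact Finset.single_le_sum (f := fun y => (branch G w y).card) (fun _ _ => Nat.zero_le _) hy
    have hsum : x u + ∑ y ∈ W, x y ≤ L * x w := by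
      refine le_of_eq_of_le ?_ (hsup w (self_mem_branch h))
      unfold adjSum
      rw [Finset.add_sum_erase]
      rw [SimpleGraph.mem_neighborFinset]
      exact h.symm
    have hrat : (∑ y ∈ W, pathRatio L (branch G w y).card) * x w ≤ ∑ y ∈ W, x y := by
      rw [Finset.sum_mul]
      exact Finset.sum_le_sum fun y hy => (hch y hy).2
    have hlt : ∑ y ∈ W, pathRatio L (branch G w y).card < L := by
      by_contra hc
      push Not at hc
      nlinarith
    -- The subtrees below `w` are replaced by one path with the same number of vertices; adding `w`
    -- raises the length by one, as `pathRatio L (c + 1)` is `1 / (L - pathRatio L c)`.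
    obtain ⟨m1, m2⟩ := PathPos.merge_sum W (fun y => (branch G w y).card)
      (fun y hy => (hch y hy).1) hlt
    rw [hcard]
    set c := ∑ y ∈ W, (branch G w y).card
    refine ⟨m1, ?_⟩
    have p1 := m1 (c + 1) (by omega) (by omega)
    have p2 := m1 (c + 2) (by omega) le_rfl
    have hxu : x u ≤ (L - pathRatio L c) * x w := by nlinarith
    rw [pathRatio, div_mul_eq_mul_div, div_le_iff₀ p2, pathSeq_add_two]
    have : pathSeq L c = pathRatio L c * pathSeq L (c + 1) := by
      rw [pathRatio, div_mul_cancel₀ _ p1.ne']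
    rw [this]
    nlinarith

/-- Lower bound for the adjacency form on a union of branches at a vertex `v`. -/
lemma formBound_or_sum_pathRatio_lt (hG : G.IsTree) [DecidableEq V] [DecidableRel G.Adj]
    (v : V) {W : Finset V} (hW : W ⊆ G.neighborFinset v) (δ : V → ℝ) (hδ : ∀ z, z ≠ v → δ z = 0)
    (L : ℝ) :
    FormBound G (insert v (W.biUnion (branch G v))) δ L ∨
      ((∀ w ∈ W, PathPos L ((branch G v w).card + 1)) ∧
        ∑ w ∈ W, pathRatio L (branch G v w).card < L + δ v) := by
  rcases formBound_or_exists_supersolution (G := G) (insert v (W.biUnion (branch G v))) δ L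
    with h | ⟨x, h0, hpos, hsup⟩
  · exact Or.inl h
  right
  have hv : 0 < x v := hpos v (Finset.mem_insert_self _ _)
  have hsub : ∀ w ∈ W, branch G v w ⊆ insert v (W.biUnion (branch G v)) := fun w hw =>
    (Finset.subset_biUnion_of_mem _ hw).trans (Finset.subset_insert _ _)
  have hnn : ∀ z, 0 ≤ x z := by
    intro z
    by_cases hz : z ∈ insert v (W.biUnion (branch G v))
    · exact (hpos z hz).le
    · exact (h0 z hz).ge
  have hch : ∀ w ∈ W, PathPos L ((branch G v w).card + 1) ∧
      pathRatio L (branch G v w).card * x v ≤ x w := by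
    intro w hw
    have hvw : G.Adj v w := by simpa using hW hw
    refine pathRatio_card_branch_le hG hvw hv (fun z hz => hpos z (hsub w hw hz)) fun z hz => ?_
    have := (hsup z (hsub w hw hz)).le
    rwa [hδ z (by rintro rfl; exact notMem_branch hz), add_zero] at this
  refine ⟨fun w hw => (hch w hw).1, ?_⟩
  have h1 : (∑ w ∈ W, pathRatio L (branch G v w).card) * x v ≤ ∑ w ∈ W, x w := by
    rw [Finset.sum_mul]
    exact Finset.sum_le_sum fun w hw => (hch w hw).2
  have h2 : ∑ w ∈ W, x w ≤ adjSum G x v := by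
    unfold adjSum
    exact (Finset.sum_le_sum_of_subset_of_nonneg hW fun z _ _ => hnn z).trans_eq
      (Finset.sum_congr (by congr!) fun _ _ => rfl)
  have h3 := hsup v (Finset.mem_insert_self _ _)
  by_contra hc
  push Not at hc
  nlinarith

/-- Eliminating all branches off the edge leaves a 2 × 2 system with off-diagonal entries -1. A
positive strict supersolution forces positive diagonal entries with product above 1. -/
lemma formBound_or_prod_gt (hG : G.IsTree) [DecidableEq V] [DecidableRel G.Adj] {u w : V}
    (h : G.Adj u w) (L : ℝ) :
    FormBound G Finset.univ 0 L ∨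
      ((∀ y ∈ (G.neighborFinset u).erase w, PathPos L ((branch G u y).card + 1)) ∧
        (∀ y ∈ (G.neighborFinset w).erase u, PathPos L ((branch G w y).card + 1)) ∧
        ∑ y ∈ (G.neighborFinset u).erase w, pathRatio L (branch G u y).card < L ∧
        ∑ y ∈ (G.neighborFinset w).erase u, pathRatio L (branch G w y).card < L ∧
        1 < (L - ∑ y ∈ (G.neighborFinset u).erase w, pathRatio L (branch G u y).card) *
          (L - ∑ y ∈ (G.neighborFinset w).erase u, pathRatio L (branch G w y).card)) := by
  rcases formBound_or_exists_supersolution (G := G) Finset.univ 0 L with h | ⟨x, -, hpos, hsup⟩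
  · exact Or.inl h
  right
  simp only [Finset.mem_univ, true_implies, Pi.zero_apply, add_zero] at hpos hsup
  have hch : ∀ v y, G.Adj v y → PathPos L ((branch G v y).card + 1) ∧
      pathRatio L (branch G v y).card * x v ≤ x y := fun v y hvy =>
    pathRatio_card_branch_le hG hvy (hpos v) (fun z _ => hpos z) fun z _ => (hsup z).le
  have hside : ∀ a b, G.Adj a b →
      x b < (L - ∑ y ∈ (G.neighborFinset a).erase b, pathRatio L (branch G a y).card) * x a := by
    intro a b hab
    have h1 : (∑ y ∈ (G.neighborFinset a).erase b, pathRatio L (branch G a y).card) * x a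
        ≤ ∑ y ∈ (G.neighborFinset a).erase b, x y := by
      rw [Finset.sum_mul]
      exact Finset.sum_le_sum fun y hy =>
        (hch a y (by simpa using Finset.mem_of_mem_erase hy)).2
    have h2 : x b + ∑ y ∈ (G.neighborFinset a).erase b, x y = adjSum G x a := by
      unfold adjSum
      rw [Finset.add_sum_erase]
      · congr!
      · simpa using hab
    have := hsup a
    linarith
  have hu := hside u w h
  have hw := hside w u h.symm
  set A := L - ∑ y ∈ (G.neighborFinset u).erase w, pathRatio L (branch G u y).card with hA
  set B := L - ∑ y ∈ (G.neighborFinset w).erase u, pathRatio L (branch G w y).card with hB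
  have hA0 : 0 < A := by
    by_contra hc
    nlinarith [hpos u, hpos w]
  have hB0 : 0 < B := by
    by_contra hc
    nlinarith [hpos u, hpos w]
  refine ⟨fun y hy => (hch u y (by simpa using Finset.mem_of_mem_erase hy)).1,
    fun y hy => (hch w y (by simpa using Finset.mem_of_mem_erase hy)).1, by linarith,
    by linarith, ?_⟩
  by_contra hc
  push Not at hc
  have h1 : x w < A * (B * x w) := hu.trans (mul_lt_mul_of_pos_left hw hA0)
  nlinarith [hpos w]

end Resolvent

/-! ### Eigenvalue bounds from branches -/

section Bounds

lemma mul_eq_zero_of_disjoint {V : Type*} {C D : Finset V} (hCD : Disjoint C D) {x y : V → ℝ}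
    (hx : ∀ z ∉ C, x z = 0) (hy : ∀ z ∉ D, y z = 0) (z : V) : x z * y z = 0 := by
  by_cases h : z ∈ C
  · rw [hy z (Finset.disjoint_left.mp hCD h), mul_zero]
  · rw [hx z h, zero_mul]

variable {V : Type*} [Fintype V] {G : SimpleGraph V}

lemma spectralSum_eq (h : 2 ≤ Fintype.card V) :
    spectralSum G = adjEigenvalues G ⟨0, by omega⟩ + adjEigenvalues G ⟨1, by omega⟩ := by
  rw [spectralSum, dif_pos h]

/-- Ky Fan's inequality needs only orthogonality, so edges between `C` and `D` are harmless here. -/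
lemma FormBound.add_le_spectralSum (h : 2 ≤ Fintype.card V) {C D : Finset V} {μ ν : ℝ}
    (hC : FormBound G C 0 μ) (hD : FormBound G D 0 ν) (hCD : Disjoint C D) :
    μ + ν ≤ spectralSum G := by
  obtain ⟨x, hx, hx0, hxq⟩ := hC
  obtain ⟨y, hy, hy0, hyq⟩ := hD
  simp only [Pi.zero_apply, zero_mul, Finset.sum_const_zero, sub_zero] at hxq hyq
  rw [spectralSum_eq h]
  exact add_le_adjEigenvalues_add G (by omega) hx0 hy0
    (Finset.sum_eq_zero fun z _ => mul_eq_zero_of_disjoint hCD hx hy z) hxq hyq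

lemma FormBound.le_adjEigenvalues_zero (h : 0 < Fintype.card V) {C : Finset V} {μ : ℝ}
    (hC : FormBound G C 0 μ) : μ ≤ adjEigenvalues G ⟨0, h⟩ := by
  obtain ⟨x, -, hx0, hxq⟩ := hC
  simp only [Pi.zero_apply, zero_mul, Finset.sum_const_zero, sub_zero] at hxq
  exact TreeSpectralSum.le_adjEigenvalues_zero G h hx0 hxq

/-- The weights `δ` and `ε` pay for the cross term along edges between `C` and `D`, so that the
level `μ` is kept on the whole plane spanned by the two weightings. -/
lemma FormBound.le_adjEigenvalues_one (h : 1 < Fintype.card V) {C D : Finset V} {μ : ℝ}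
    {δ ε : V → ℝ} (hC : FormBound G C δ μ) (hD : FormBound G D ε μ) (hCD : Disjoint C D)
    (hcross : ∀ x y : V → ℝ, (∀ z ∉ C, x z = 0) → (∀ z ∉ D, y z = 0) →
      -(2 * ∑ z, x z * adjSum G y z) ≤ ∑ z, δ z * x z ^ 2 + ∑ z, ε z * y z ^ 2) :
    μ ≤ adjEigenvalues G ⟨1, h⟩ := by
  obtain ⟨x, hx, hx0, hxq⟩ := hC
  obtain ⟨y, hy, hy0, hyq⟩ := hD
  have hnorm : ∀ a b : ℝ, ∑ v, (a * x v + b * y v) ^ 2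
      = a ^ 2 * ∑ v, x v ^ 2 + b ^ 2 * ∑ v, y v ^ 2 := by
    intro a b
    rw [Finset.mul_sum, Finset.mul_sum, ← Finset.sum_add_distrib]
    refine Finset.sum_congr rfl fun z _ => ?_
    linear_combination 2 * a * b * mul_eq_zero_of_disjoint hCD hx hy z
  refine TreeSpectralSum.le_adjEigenvalues_one G h (x := x) (y := y) (fun a b hab => ?_)
    fun a b => ?_
  · rw [hnorm]
    rcases hab with ha | hb
    · have : 0 < a ^ 2 := by positivity
      nlinarith [mul_pos this hx0, mul_nonneg (sq_nonneg b) hy0.le]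
    · have : 0 < b ^ 2 := by positivity
      nlinarith [mul_pos this hy0, mul_nonneg (sq_nonneg a) hx0.le]
  · rw [hnorm, adjForm_comb]
    have h1 := hcross (fun z => a * x z) (fun z => b * y z) (fun z hz => by simp [hx z hz])
      fun z hz => by simp [hy z hz]
    have e1 : ∑ z, a * x z * adjSum G (fun z => b * y z) z
        = a * b * ∑ z, x z * adjSum G y z := by
      rw [Finset.mul_sum]
      refine Finset.sum_congr rfl fun z _ => ?_
      have : adjSum G (fun z => b * y z) z = b * adjSum G y z := by
        unfold adjSum
        rw [Finset.mul_sum]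
      rw [this]
      ring
    have e2 : ∑ z, δ z * (a * x z) ^ 2 = a ^ 2 * ∑ z, δ z * x z ^ 2 := by
      rw [Finset.mul_sum]
      exact Finset.sum_congr rfl fun z _ => by ring
    have e3 : ∑ z, ε z * (b * y z) ^ 2 = b ^ 2 * ∑ z, ε z * y z ^ 2 := by
      rw [Finset.mul_sum]
      exact Finset.sum_congr rfl fun z _ => by ring
    rw [e1, e2, e3] at h1
    have h2 := mul_le_mul_of_nonneg_left hxq (sq_nonneg a)
    have h3 := mul_le_mul_of_nonneg_left hyq (sq_nonneg b)
    linarith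

lemma sum_mul_adjSum_eq_zero {C D : Finset V} (hadj : ∀ z ∈ C, ∀ z' ∈ D, ¬ G.Adj z z')
    {x y : V → ℝ} (hx : ∀ z ∉ C, x z = 0) (hy : ∀ z ∉ D, y z = 0) :
    ∑ z, x z * adjSum G y z = 0 := by
  refine Finset.sum_eq_zero fun z _ => ?_
  by_cases hz : z ∈ C
  · unfold adjSum
    rw [Finset.sum_eq_zero, mul_zero]
    intro z' hz'
    refine hy z' fun hc => hadj z hz z' hc (by simpa using hz')
  · rw [hx z hz, zero_mul]

lemma branch_eq_insert (hG : G.IsTree) [DecidableEq V] [DecidableRel G.Adj] {u w : V}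
    (h : G.Adj u w) :
    insert w (((G.neighborFinset w).erase u).biUnion (branch G w)) = branch G u w := by
  ext x
  simp only [Finset.mem_insert, Finset.mem_biUnion, Finset.mem_erase,
    SimpleGraph.mem_neighborFinset]
  constructor
  · rintro (rfl | ⟨y, ⟨hyu, hy⟩, hxy⟩)
    · exact self_mem_branch h
    · exact branch_subset hG h hy hyu hxy
  · intro hx
    by_cases hxw : x = w
    · exact Or.inl hxw
    · obtain ⟨y, hy, hxy⟩ := exists_adj_mem_branch hG.connected hxw
      refine Or.inr ⟨y, ⟨?_, hy⟩, hxy⟩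
      rintro rfl
      exact (mem_branch_symm hG h).mp hxy hx

/-- A nonpositive value of the characteristic polynomial of the path on `k` vertices shows that `μ`
is at most its top eigenvalue; a branch with at least `k` vertices does as well as that path. -/
lemma formBound_branch (hG : G.IsTree) {u w : V} (h : G.Adj u w) {k : ℕ} {μ : ℝ}
    (hk : k ≤ (branch G u w).card) (hμ : pathSeq μ (k + 1) ≤ 0) :
    FormBound G (branch G u w) 0 μ := by
  classical
  have hroot := formBound_or_sum_pathRatio_lt hG w (Finset.erase_subset u (G.neighborFinset w)) 0
    (fun _ _ => rfl) μ
  rw [branch_eq_insert hG h] at hroot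
  rcases hroot with h1 | ⟨h1, h2⟩
  · exact h1
  · exfalso
    rw [Pi.zero_apply, add_zero] at h2
    have := (PathPos.merge_sum _ _ h1 h2).1 (k + 1) (by omega) (by
      rw [card_branch hG h] at hk
      omega)
    linarith

lemma formBound_univ_or (hG : G.IsTree) [DecidableRel G.Adj] (v : V) (L : ℝ) :
    FormBound G Finset.univ 0 L ∨ ((∀ w ∈ G.neighborFinset v, PathPos L ((branch G v w).card + 1)) ∧
        ∑ w ∈ G.neighborFinset v, pathRatio L (branch G v w).card < L) := by
  classical
  rcases formBound_or_sum_pathRatio_lt hG v (Finset.Subset.refl (G.neighborFinset v)) 0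
    (fun _ _ => rfl) L with ⟨x, -, h⟩ | h
  · exact Or.inl ⟨x, fun z hz => absurd (Finset.mem_univ z) hz, h⟩
  · rw [Pi.zero_apply, add_zero] at h
    exact Or.inr h

lemma formBound_univ (hG : G.IsTree) {k : ℕ} {μ : ℝ}
    (hk : k ≤ Fintype.card V) (hμ : pathSeq μ (k + 1) ≤ 0) :
    FormBound G Finset.univ 0 μ := by
  classical
  obtain ⟨v⟩ := hG.connected.nonempty
  rcases formBound_univ_or hG v μ with h1 | ⟨h1, h2⟩
  · exact h1
  · exfalso
    have := (PathPos.merge_sum _ _ h1 h2).1 (k + 1) (by omega) (by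
      rw [card_eq_one_add_sum_branch hG v] at hk
      omega)
    linarith

lemma disjoint_branch (hG : G.IsTree) {z w w' : V} (hw : G.Adj z w) (hw' : G.Adj z w')
    (hne : w ≠ w') : Disjoint (branch G z w) (branch G z w') :=
  Finset.disjoint_left.mpr fun _ hx hx' => hne (branch_unique hG hw hw' hx hx')

/-- Two branches at a vertex with at least `k` vertices each bound the second eigenvalue. -/
lemma le_adjEigenvalues_one_of_branches (hG : G.IsTree) (h : 1 < Fintype.card V) {z w w' : V}
    (hw : G.Adj z w) (hw' : G.Adj z w') (hne : w ≠ w') {k : ℕ} {μ : ℝ}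
    (hk : k ≤ (branch G z w).card) (hk' : k ≤ (branch G z w').card)
    (hμ : pathSeq μ (k + 1) ≤ 0) : μ ≤ adjEigenvalues G ⟨1, h⟩ := by
  have hdis := disjoint_branch hG hw hw' hne
  refine (formBound_branch hG hw hk hμ).le_adjEigenvalues_one h (formBound_branch hG hw' hk' hμ)
    hdis fun x y hx hy => ?_
  rw [sum_mul_adjSum_eq_zero (C := branch G z w) (D := branch G z w') ?_ hx hy]
  · simp
  · intro a ha b hb hab
    have hb' : b ∉ branch G z w := fun hc => Finset.disjoint_left.mp hdis hc hb
    obtain ⟨-, rfl⟩ := eq_of_adj_of_mem_branch hG hw hab ha hb'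
    exact notMem_branch hb

/-- A form of `le_adjEigenvalues_one_of_branches` in which the two parts are adjacent. -/
lemma le_adjEigenvalues_one_of_adj (hG : G.IsTree) (h : 1 < Fintype.card V) {u w y y' : V}
    (huw : G.Adj u w) (hy : G.Adj u y) (hy' : G.Adj w y') (hyw : y ≠ w) (hyu : y' ≠ u) {k : ℕ}
    {μ : ℝ} (hk : k ≤ (branch G u y).card) (hk' : k ≤ (branch G w y').card)
    (hμ : pathSeq μ (k + 1) * (μ + 1) ≤ pathSeq μ k) : μ ≤ adjEigenvalues G ⟨1, h⟩ := by
  classical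
  -- The model is the antisymmetric second eigenvector of the path on `2k + 2` vertices: each half
  -- is a path on `k + 1` vertices with weight -1 at its inner end, and `hμ` says `μ + 1 ≤ pathRatio
  -- μ k`.
  have key : ∀ a b c : V, G.Adj a b → G.Adj a c → k ≤ (branch G a c).card →
      FormBound G (insert a (branch G a c)) (Pi.single a 1) μ := by
    intro a b c _ hac hkc
    have := formBound_or_sum_pathRatio_lt hG a (W := {c}) (by simpa using hac) (Pi.single a 1)
      (fun z hz => by simp [hz]) μ
    rw [Finset.singleton_biUnion] at this
    refine this.resolve_right fun ⟨h1, h2⟩ => ?_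
    simp only [Finset.sum_singleton, Pi.single_eq_same] at h2
    have hp := h1 c (Finset.mem_singleton_self c)
    have h3 := hp.ratio_mono hkc le_rfl
    have h4 := hp (k + 1) (by omega) (by omega)
    have h5 : μ + 1 ≤ pathRatio μ k := by
      rw [pathRatio, le_div_iff₀ h4]
      linarith
    linarith
  have hsubA : insert u (branch G u y) ⊆ branch G w u :=
    Finset.insert_subset (self_mem_branch huw.symm) (branch_subset hG huw.symm hy hyw)
  have hsubB : insert w (branch G w y') ⊆ branch G u w :=
    Finset.insert_subset (self_mem_branch huw) (branch_subset hG huw hy' hyu)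
  have hdis : Disjoint (insert u (branch G u y)) (insert w (branch G w y')) :=
    Finset.disjoint_left.mpr fun z hz hz' =>
      (mem_branch_symm hG huw).mp (hsubA hz) (hsubB hz')
  refine (key u w y huw hy hk).le_adjEigenvalues_one h (key w u y' huw.symm hy' hk') hdis
    fun a b ha hb => ?_
  have e1 : ∀ (v : V) (c : V → ℝ), ∑ z, (Pi.single v 1 : V → ℝ) z * c z ^ 2 = c v ^ 2 := by
    intro v c
    simp [Pi.single_apply]
  have e2 : ∑ z, a z * adjSum G b z = a u * b w := by
    rw [Finset.sum_eq_single u]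
    · congr 1
      unfold adjSum
      rw [Finset.sum_eq_single w]
      · intro z hz hzw
        by_contra hc
        have hzB : z ∈ branch G u w := hsubB (by_contra fun h' => hc (hb z h'))
        refine hzw (branch_unique hG (by simpa using hz) huw (x := z) ?_ hzB)
        exact self_mem_branch (by simpa using hz)
      · intro hw
        exact absurd (by simpa using huw) hw
    · intro z _ hzu
      by_contra hc
      have hzA : z ∈ branch G w u :=
        hsubA (by_contra fun h' => hc (by rw [ha z h', zero_mul]))
      refine hc ?_
      rw [adjSum, Finset.sum_eq_zero, mul_zero]
      intro z' hz'
      refine hb z' fun hz'B => ?_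
      refine hzu (eq_of_adj_of_mem_branch hG huw.symm (x := z) (y := z') (by simpa using hz') hzA
        ?_).1
      rw [mem_branch_symm hG huw, not_not]
      exact hsubB hz'B
    · simp
  rw [e1, e1, e2]
  -- The edge `u w` is the only contact of the two parts, and the unit weights at its ends absorb
  -- its cross term.
  nlinarith [sq_nonneg (a u + b w)]

lemma disjoint_branch_symm (hG : G.IsTree) {u w : V} (h : G.Adj u w) :
    Disjoint (branch G w u) (branch G u w) :=
  Finset.disjoint_left.mpr fun _ hz hz' => (mem_branch_symm hG h).mp hz hz'

/-- Splitting the tree at an edge `uw`: one side is bounded by its branches at `u`, the other one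
by its number of vertices. -/
lemma add_le_spectralSum_of_edge (hG : G.IsTree) (h : 2 ≤ Fintype.card V) [DecidableEq V]
    [DecidableRel G.Adj] {u w : V} (huw : G.Adj u w) {k : ℕ} {L μ : ℝ}
    (hL : L ≤ ∑ y ∈ (G.neighborFinset u).erase w, pathRatio L (branch G u y).card)
    (hk : k ≤ (branch G u w).card) (hμ : pathSeq μ (k + 1) ≤ 0) : L + μ ≤ spectralSum G := by
  have hroot := formBound_or_sum_pathRatio_lt hG u (Finset.erase_subset w (G.neighborFinset u)) 0
    (fun _ _ => rfl) L
  rw [branch_eq_insert hG huw.symm] at hroot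
  have hA : FormBound G (branch G w u) 0 L := by
    refine hroot.resolve_right fun hc => ?_
    have := hc.2
    rw [Pi.zero_apply, add_zero] at this
    linarith
  exact hA.add_le_spectralSum h (formBound_branch hG huw hk hμ) (disjoint_branch_symm hG huw)

end Bounds

/-! ### The central vertex or central edge -/

section Center

variable {V : Type*} [Fintype V] {G : SimpleGraph V}

/-- The largest size `N` for which some vertex has two branches with at least `N` vertices each,
together with the resulting central vertex or central edge. -/
lemma exists_center (hG : G.IsTree) (h : 3 ≤ Fintype.card V) :
    ∃ N, 1 ≤ N ∧ (∃ z w w', G.Adj z w ∧ G.Adj z w' ∧ w ≠ w' ∧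
        N ≤ (branch G z w).card ∧ N ≤ (branch G z w').card) ∧
      ((∃ z, ∀ w, G.Adj z w → (branch G z w).card ≤ N) ∨
        ∃ u w, G.Adj u w ∧ N + 1 ≤ (branch G u w).card ∧
          (branch G u w).card ≤ (branch G w u).card ∧
          (∀ y, G.Adj u y → y ≠ w → (branch G u y).card ≤ N) ∧
          (∀ y, G.Adj w y → y ≠ u → (branch G w y).card ≤ N)) := by
  classical
  let P : ℕ → Prop := fun N => ∃ z w w', G.Adj z w ∧ G.Adj z w' ∧ w ≠ w' ∧
    N ≤ (branch G z w).card ∧ N ≤ (branch G z w').card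
  have hP1 : P 1 := by
    by_contra hc
    have hdeg : ∀ z w w', G.Adj z w → G.Adj z w' → w = w' := by
      intro z w w' h1 h2
      by_contra hne
      exact hc ⟨z, w, w', h1, h2, hne, Finset.card_pos.mpr ⟨w, self_mem_branch h1⟩,
        Finset.card_pos.mpr ⟨w', self_mem_branch h2⟩⟩
    obtain ⟨v⟩ := hG.connected.nonempty
    have : Fintype.card V ≤ 2 := by
      obtain ⟨x, hx⟩ := Fintype.exists_ne_of_one_lt_card (by omega : 1 < Fintype.card V) v
      obtain ⟨w, hvw, -⟩ := exists_adj_mem_branch hG.connected hx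
      have hall : ∀ y, y = v ∨ y = w := by
        intro y
        by_contra hy
        push Not at hy
        obtain ⟨w1, hw1, hyw⟩ := exists_adj_mem_branch hG.connected hy.1
        obtain rfl := hdeg _ _ _ hvw hw1
        obtain ⟨y1, hy1, hyy⟩ := exists_adj_mem_branch hG.connected hy.2
        obtain rfl := hdeg _ _ _ hvw.symm hy1
        exact (mem_branch_symm hG hvw).mp hyy hyw
      rw [← Finset.card_univ]
      refine (Finset.card_le_card (t := {v, w}) fun y _ => ?_).trans Finset.card_le_two
      simpa using hall y
    omega
  have hbound : ∀ N, P N → N ≤ Fintype.card V := by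
    rintro N ⟨z, w, -, -, -, -, hN, -⟩
    exact hN.trans (Finset.card_le_univ _)
  set N := Nat.findGreatest P (Fintype.card V) with hN
  have hPN : P N := Nat.findGreatest_spec (P := P) (by omega) hP1
  have hmax : ∀ z w w', G.Adj z w → G.Adj z w' → w ≠ w' → N + 1 ≤ (branch G z w).card →
      (branch G z w').card ≤ N := by
    intro z w w' h1 h2 hne h3
    by_contra hc
    push Not at hc
    have hP : P (N + 1) := ⟨z, w, w', h1, h2, hne, h3, hc⟩
    exact Nat.findGreatest_is_greatest (P := P) (Nat.lt_succ_self _) (hbound _ hP) hP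
  refine ⟨N, Nat.le_findGreatest (by omega) hP1, hPN, ?_⟩
  by_cases hI : ∃ z, ∀ w, G.Adj z w → (branch G z w).card ≤ N
  · exact Or.inl hI
  right
  push Not at hI
  choose f hf1 hf2 using hI
  obtain ⟨v⟩ := hG.connected.nonempty
  -- `f` points from each vertex into a branch with more than `N` vertices. Following it shrinks
  -- that branch strictly unless it points back, so at a minimum it reverses and yields the central
  -- edge.
  obtain ⟨u, -, hu⟩ := Finset.exists_min_image Finset.univ (fun u => (branch G u (f u)).card)
    ⟨v, Finset.mem_univ v⟩
  have hfu : f (f u) = u := by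
    by_contra hne
    have hss : branch G (f u) (f (f u)) ⊂ branch G u (f u) := by
      refine Finset.ssubset_iff_subset_ne.mpr ⟨branch_subset hG (hf1 u) (hf1 _) hne, fun heq => ?_⟩
      have := self_mem_branch (hf1 u)
      rw [← heq] at this
      exact notMem_branch this
    exact absurd (Finset.card_lt_card hss) (not_lt.mpr (hu (f u) (Finset.mem_univ _)))
  have hle := hu (f u) (Finset.mem_univ _)
  have h1 := hf1 u
  have h2 := hf2 u
  have h3 := hf2 (f u)
  rw [hfu] at hle h3
  refine ⟨u, f u, h1, h2, hle, fun y hy hyw => ?_, fun y hy hyu => ?_⟩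
  · exact hmax u (f u) y h1 hy (Ne.symm hyw) h2
  · exact hmax (f u) u y h1.symm hy (Ne.symm hyu) h3

end Center

/-! ### Integer arithmetic with common denominator 60000 -/

section Numeric

/-- Lower bounds for `60000 * pathRatio (l / 60000)` in natural numbers. -/
def ratioLB (l : ℕ) : ℕ → ℕ
  | 0 => 0
  | c + 1 => 60000 * 60000 / (l - ratioLB l c)

/-- For `N = 1` the division by zero gives slope 0, as wanted. -/
def slopeLB (l N : ℕ) : ℕ := (ratioLB l N - ratioLB l 1) / (N - 1)

/-- Lower bound for the sum of `ratioLB l` over `k` numbers in `[1, N]` with sum `S`, obtained from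
the chord of `ratioLB l` over that interval. -/
def chordLB (l N S k : ℕ) : ℕ := k * (ratioLB l 1 - slopeLB l N) + S * slopeLB l N

/-- The chord used in `chordLB` stays below `ratioLB l`. -/
def chordOK (l N : ℕ) : Bool :=
  decide (slopeLB l N ≤ ratioLB l 1) &&
    (List.range N).all fun c =>
      decide (ratioLB l 1 - slopeLB l N + slopeLB l N * (c + 1) ≤ ratioLB l (c + 1))

lemma ratioLB_le {l : ℕ} (hl : 120000 ≤ l) (c : ℕ) :
    (ratioLB l c : ℝ) / 60000 ≤ pathRatio ((l : ℝ) / 60000) c := by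
  have hL : (2 : ℝ) ≤ (l : ℝ) / 60000 := by
    rw [le_div_iff₀ (by norm_num)]
    exact_mod_cast (by omega : 2 * 60000 ≤ l)
  induction c with
  | zero => simp [ratioLB, pathRatio_zero]
  | succ c ih =>
    have h1 : pathRatio ((l : ℝ) / 60000) c < (l : ℝ) / 60000 := by
      have p1 := pathPos_of_two_le hL (c + 1) (c + 1) (by omega) le_rfl
      have p2 := pathPos_of_two_le hL (c + 2) (c + 2) (by omega) le_rfl
      rw [pathSeq_add_two] at p2
      rw [pathRatio, div_lt_iff₀ p1]
      linarith
    rw [pathRatio_succ hL, ratioLB]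
    have h2 : ratioLB l c < l := by
      have : (ratioLB l c : ℝ) / 60000 < (l : ℝ) / 60000 := ih.trans_lt h1
      rw [div_lt_div_iff_of_pos_right (by norm_num)] at this
      exact_mod_cast this
    have h3 : ((l - ratioLB l c : ℕ) : ℝ) = (l : ℝ) - ratioLB l c := by
      push_cast [h2.le]
      ring
    have h4 : (0 : ℝ) < (l : ℝ) - ratioLB l c := by
      have : (ratioLB l c : ℝ) < l := by exact_mod_cast h2
      linarith
    have h5 : ((60000 * 60000 / (l - ratioLB l c) : ℕ) : ℝ)
        ≤ 60000 * 60000 / ((l : ℝ) - ratioLB l c) := by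
      rw [← h3]
      have := @Nat.cast_div_le ℝ _ _ _ (60000 * 60000) (l - ratioLB l c)
      push_cast at this ⊢
      norm_num at this ⊢
      exact this
    calc ((60000 * 60000 / (l - ratioLB l c) : ℕ) : ℝ) / 60000
        ≤ 60000 * 60000 / ((l : ℝ) - ratioLB l c) / 60000 := by gcongr
      _ = 1 / (((l : ℝ) - ratioLB l c) / 60000) := by field_simp
      _ ≤ 1 / ((l : ℝ) / 60000 - pathRatio ((l : ℝ) / 60000) c) := by
        refine one_div_le_one_div_of_le (by linarith) ?_
        rw [sub_div]
        linarith

/-- Capping the sizes at `N` only lowers the ratios, which are monotone. Intercept and slope are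
natural numbers, so lower bounds for the number of terms and for their capped sum suffice. -/
lemma line_sum_le {ι : Type*} {W : Finset ι} {c : ι → ℕ} {l x y N c₀ k S : ℕ} (hl : 120000 ≤ l)
    (hline : ∀ a, c₀ ≤ a → a ≤ N → x + y * a ≤ ratioLB l a) (hN : c₀ ≤ N)
    (hc : ∀ w ∈ W, c₀ ≤ c w) (hk : k ≤ W.card) (hS : S ≤ ∑ w ∈ W, min (c w) N) :
    ((k * x + S * y : ℕ) : ℝ) / 60000 ≤ ∑ w ∈ W, pathRatio ((l : ℝ) / 60000) (c w) := by
  have hL : (2 : ℝ) ≤ (l : ℝ) / 60000 := by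
    rw [le_div_iff₀ (by norm_num)]
    exact_mod_cast (by omega : 2 * 60000 ≤ l)
  have h1 : k * x + S * y ≤ ∑ w ∈ W, ratioLB l (min (c w) N) := by
    calc k * x + S * y ≤ W.card * x + (∑ w ∈ W, min (c w) N) * y := by gcongr
      _ = ∑ w ∈ W, (x + y * min (c w) N) := by
        rw [Finset.sum_add_distrib, Finset.sum_const, smul_eq_mul, ← Finset.mul_sum, mul_comm y]
      _ ≤ _ := Finset.sum_le_sum fun w hw =>
        hline _ (le_min (hc w hw) hN) (min_le_right _ _)
  calc ((k * x + S * y : ℕ) : ℝ) / 60000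
      ≤ ((∑ w ∈ W, ratioLB l (min (c w) N) : ℕ) : ℝ) / 60000 := by gcongr
    _ = ∑ w ∈ W, (ratioLB l (min (c w) N) : ℝ) / 60000 := by
      rw [Nat.cast_sum, Finset.sum_div]
    _ ≤ _ := Finset.sum_le_sum fun w _ => (ratioLB_le hl _).trans
      (pathRatio_mono hL (min_le_left _ _))

lemma chord_sum_le {ι : Type*} {W : Finset ι} {c : ι → ℕ} {l N k S : ℕ} (hl : 120000 ≤ l)
    (hok : chordOK l N = true) (hN : 1 ≤ N)
    (hc : ∀ w ∈ W, 1 ≤ c w) (hk : k ≤ W.card) (hS : S ≤ ∑ w ∈ W, min (c w) N) :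
    (chordLB l N S k : ℝ) / 60000 ≤ ∑ w ∈ W, pathRatio ((l : ℝ) / 60000) (c w) := by
  refine line_sum_le (x := ratioLB l 1 - slopeLB l N) (y := slopeLB l N) hl (fun a h1 h2 => ?_)
    hN hc hk hS
  simp only [chordOK, Bool.and_eq_true, decide_eq_true_eq, List.all_eq_true, List.mem_range] at hok
  obtain ⟨d, rfl⟩ := Nat.exists_eq_add_of_le' h1
  exact hok.2 d (by omega)

/-- Rounded up quotient. -/
def ceilQuot (S N : ℕ) : ℕ := (S + N - 1) / N

lemma ceilQuot_le {S N k : ℕ} (hN : 1 ≤ N) (h : S ≤ k * N) : ceilQuot S N ≤ k := by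
  rw [ceilQuot, ← Nat.lt_succ_iff, Nat.div_lt_iff_lt_mul hN, Nat.succ_mul]
  omega

/-- Numerical criterion for a central vertex. -/
def vertexOK (l N S k : ℕ) : Bool := chordOK l N && decide (l ≤ chordLB l N S k)

/-- Numerical criterion for a central edge, from the branches on both sides. -/
def edgeOK (l Na Nb a b ka kb : ℕ) : Bool :=
  chordOK l Na && chordOK l Nb &&
    decide ((l - max (chordLB l Na a ka) (ratioLB l a)) *
      (l - max (chordLB l Nb b kb) (ratioLB l b)) ≤ 60000 * 60000)

/-- Lower bounds for `60000 * (2 * cos (π / (k + 1)))`. -/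
def pathEigLB (k : ℕ) : ℕ :=
  if k ≤ 9 then [0, 0, 60000, 84852, 97082, 103923, 108116, 110865, 112763, 114126].getD k 0
  else 114126

/-- The entries are top path eigenvalues rounded down, where the characteristic polynomial is
nonpositive; longer paths fall back on the entry for 9 vertices. -/
lemma pathSeq_pathEigLB {k : ℕ} (hk : 1 ≤ k) :
    ∃ j ≤ k, pathSeq ((pathEigLB k : ℝ) / 60000) (j + 1) ≤ 0 := by
  by_cases h : k ≤ 9
  · refine ⟨k, le_rfl, ?_⟩
    interval_cases k <;> norm_num [pathEigLB, pathSeq]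
  · refine ⟨9, by omega, ?_⟩
    norm_num [pathEigLB, pathSeq, h]

end Numeric

/-! ### Soundness of the numerical criteria -/

section Criteria

variable {V : Type*} [Fintype V] {G : SimpleGraph V}

lemma one_le_card_branch {u w : V} (h : G.Adj u w) : 1 ≤ (branch G u w).card :=
  Finset.card_pos.mpr ⟨w, self_mem_branch h⟩

lemma two_le_cast_div {l : ℕ} (hl : 120000 ≤ l) : (2 : ℝ) ≤ (l : ℝ) / 60000 := by
  rw [le_div_iff₀ (by norm_num)]
  exact_mod_cast (by omega : 2 * 60000 ≤ l)

lemma le_adjEigenvalues_zero_of_vertex (hG : G.IsTree) (h : 0 < Fintype.card V)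
    [DecidableRel G.Adj] (z : V) {l N S k : ℕ} (hl : 120000 ≤ l) (hN : 1 ≤ N)
    (hk : k ≤ (G.neighborFinset z).card)
    (hS : S ≤ ∑ w ∈ G.neighborFinset z, min (branch G z w).card N)
    (hok : vertexOK l N S k = true) : (l : ℝ) / 60000 ≤ adjEigenvalues G ⟨0, h⟩ := by
  simp only [vertexOK, Bool.and_eq_true, decide_eq_true_eq] at hok
  have h1 := chord_sum_le hl hok.1 hN
    (fun w hw => one_le_card_branch (G := G) (by simpa using hw)) hk hS
  refine ((formBound_univ_or hG z _).resolve_right fun hc => ?_).le_adjEigenvalues_zero h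
  have h2 : (l : ℝ) / 60000 ≤ (chordLB l N S k : ℝ) / 60000 := by
    gcongr
    exact_mod_cast hok.2
  linarith [hc.2]

lemma le_adjEigenvalues_zero_of_edge (hG : G.IsTree) (h : 0 < Fintype.card V)
    [DecidableEq V] [DecidableRel G.Adj] {u w : V} (huw : G.Adj u w) {l Na Nb a b ka kb : ℕ}
    (hl : 120000 ≤ l) (hNa : 1 ≤ Na) (hNb : 1 ≤ Nb)
    (hka : ka ≤ ((G.neighborFinset u).erase w).card)
    (hkb : kb ≤ ((G.neighborFinset w).erase u).card)
    (ha : a ≤ ∑ y ∈ (G.neighborFinset u).erase w, min (branch G u y).card Na)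
    (hb : b ≤ ∑ y ∈ (G.neighborFinset w).erase u, min (branch G w y).card Nb)
    (hok : edgeOK l Na Nb a b ka kb = true) : (l : ℝ) / 60000 ≤ adjEigenvalues G ⟨0, h⟩ := by
  simp only [edgeOK, Bool.and_eq_true, decide_eq_true_eq] at hok
  obtain ⟨⟨hokA, hokB⟩, hprod⟩ := hok
  refine ((formBound_or_prod_gt hG huw ((l : ℝ) / 60000)).resolve_right ?_).le_adjEigenvalues_zero h
  rintro ⟨-, -, hA, hB, hgt⟩
  have hL := two_le_cast_div hl
  have key : ∀ (v v' : V) (N c k : ℕ), 1 ≤ N → k ≤ ((G.neighborFinset v).erase v').card →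
      c ≤ ∑ y ∈ (G.neighborFinset v).erase v', min (branch G v y).card N → chordOK l N = true →
      ∑ y ∈ (G.neighborFinset v).erase v', pathRatio ((l : ℝ) / 60000) (branch G v y).card
        < (l : ℝ) / 60000 →
      0 ≤ (l : ℝ) / 60000 - ∑ y ∈ (G.neighborFinset v).erase v',
        pathRatio ((l : ℝ) / 60000) (branch G v y).card ∧
      (l : ℝ) / 60000 - ∑ y ∈ (G.neighborFinset v).erase v',
        pathRatio ((l : ℝ) / 60000) (branch G v y).card
        ≤ ((l - max (chordLB l N c k) (ratioLB l c) : ℕ) : ℝ) / 60000 := by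
    intro v v' N c k hN hk hc hok hlt
    refine ⟨by linarith, ?_⟩
    have h1 := chord_sum_le hl hok hN (fun y hy => one_le_card_branch (G := G)
      (by simpa using Finset.mem_of_mem_erase hy)) hk hc
    -- Besides the chord bound, subadditivity bounds the sum below by the ratio of a single path
    -- with as many vertices.
    have h2 := (PathPos.merge_sum _ _ (fun y _ => pathPos_of_two_le hL _) hlt).2
    have h3 := (ratioLB_le hl c).trans (pathRatio_mono hL
      (hc.trans (Finset.sum_le_sum fun y _ => min_le_left _ _)))
    have h4 : (l : ℝ) - max (chordLB l N c k : ℝ) (ratioLB l c)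
        ≤ ((l - max (chordLB l N c k) (ratioLB l c) : ℕ) : ℝ) := by
      rw [← Nat.cast_max]
      have h5 : l ≤ (l - max (chordLB l N c k) (ratioLB l c))
          + max (chordLB l N c k) (ratioLB l c) := by omega
      have : (l : ℝ) ≤ ((l - max (chordLB l N c k) (ratioLB l c) : ℕ) : ℝ)
          + ((max (chordLB l N c k) (ratioLB l c) : ℕ) : ℝ) := by exact_mod_cast h5
      linarith
    have h5 : max (chordLB l N c k : ℝ) (ratioLB l c) / 60000
        ≤ ∑ y ∈ (G.neighborFinset v).erase v',
          pathRatio ((l : ℝ) / 60000) (branch G v y).card := by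
      rcases max_choice (chordLB l N c k : ℝ) (ratioLB l c) with hm | hm
      · rw [hm]
        exact h1
      · rw [hm]
        exact h3.trans h2
    calc _ ≤ (l : ℝ) / 60000 - max (chordLB l N c k : ℝ) (ratioLB l c) / 60000 := by linarith
      _ = ((l : ℝ) - max (chordLB l N c k : ℝ) (ratioLB l c)) / 60000 := by ring
      _ ≤ _ := by gcongr
  obtain ⟨a0, a1⟩ := key u w Na a ka hNa hka ha hokA hA
  obtain ⟨b0, b1⟩ := key w u Nb b kb hNb hkb hb hokB hB
  have h1 := mul_le_mul a1 b1 b0 (a0.trans a1)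
  have h2 : ((l - max (chordLB l Na a ka) (ratioLB l a) : ℕ) : ℝ) / 60000 *
      (((l - max (chordLB l Nb b kb) (ratioLB l b) : ℕ) : ℝ) / 60000) ≤ 1 := by
    rw [div_mul_div_comm, div_le_one (by norm_num)]
    exact_mod_cast hprod
  linarith

lemma le_spectralSum_of_le (h : 2 ≤ Fintype.card V) {l m g : ℕ} (hg : g ≤ l + m)
    (h0 : (l : ℝ) / 60000 ≤ adjEigenvalues G ⟨0, by omega⟩)
    (h1 : (m : ℝ) / 60000 ≤ adjEigenvalues G ⟨1, by omega⟩) :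
    (g : ℝ) / 60000 ≤ spectralSum G := by
  rw [spectralSum_eq h]
  have : (g : ℝ) ≤ l + m := by exact_mod_cast hg
  calc (g : ℝ) / 60000 ≤ (l + m) / 60000 := by gcongr
    _ = (l : ℝ) / 60000 + (m : ℝ) / 60000 := by ring
    _ ≤ _ := add_le_add h0 h1

/-- Cutting the edge, the side of `u` supplies the first summand through its branches at `u`, and
the side of `w` supplies a path eigenvalue. -/
lemma le_spectralSum_of_split (hG : G.IsTree) (h : 2 ≤ Fintype.card V)
    [DecidableEq V] [DecidableRel G.Adj] {u w : V} (huw : G.Adj u w) {l N a b k g : ℕ}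
    (hl : 120000 ≤ l) (hN : 1 ≤ N) (hg : g ≤ l + pathEigLB b)
    (hk : k ≤ ((G.neighborFinset u).erase w).card)
    (ha : a ≤ ∑ y ∈ (G.neighborFinset u).erase w, min (branch G u y).card N)
    (hb1 : 1 ≤ b) (hb : b ≤ (branch G u w).card)
    (hok : vertexOK l N a k = true) : (g : ℝ) / 60000 ≤ spectralSum G := by
  simp only [vertexOK, Bool.and_eq_true, decide_eq_true_eq] at hok
  have h1 := chord_sum_le hl hok.1 hN (fun y hy => one_le_card_branch (G := G)
      (by simpa using Finset.mem_of_mem_erase hy)) hk ha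
  have h2 : (l : ℝ) / 60000 ≤ (chordLB l N a k : ℝ) / 60000 := by
    gcongr
    exact_mod_cast hok.2
  obtain ⟨j, hj, hj'⟩ := pathSeq_pathEigLB hb1
  have h3 := add_le_spectralSum_of_edge hG h huw (h2.trans h1) (hj.trans hb) hj'
  have : (g : ℝ) ≤ l + pathEigLB b := by exact_mod_cast hg
  calc (g : ℝ) / 60000 ≤ (l + pathEigLB b) / 60000 := by gcongr
    _ = (l : ℝ) / 60000 + (pathEigLB b : ℝ) / 60000 := by ring
    _ ≤ _ := h3

end Criteria

/-! ### Kernel-checked tables over order and level -/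

section Tables

/-- Strict upper bounds for `60000` times the spectral sum of the conjectured minimizer. -/
def goalUB (n : ℕ) : ℕ :=
  if n ≤ 22 then
    [103924, 120001, 134165, 146970, 158746, 169706, 180001, 189737, 198998, 207847, 216334,
      224500, 229854, 230941, 231862, 232650, 233329, 233918, 234433].getD (n - 4) 0
  else 240000

/-- Lower bounds for `60000` times the largest eigenvalue of a tree with `n ≤ 15` vertices. -/
def smallEigLB (n : ℕ) : ℕ :=
  [97082, 103923, 108116, 110865, 112763, 114126, 115139, 115911, 116513, 116991, 117377,
    117694].getD (n - 4) 0

/-- The level required of the first eigenvalue when the second is at least `m / 60000`, raised to 2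
so that `pathRatio` is monotone. -/
def levelLB (g m : ℕ) : ℕ := max 120000 (g - m)

/-- Three alternatives: the determinant at the edge together with the level `N`, or cutting the edge
and taking the larger summand from either side. Here `a` and `b` count the vertices on the two
sides, so `a - 1` and `b - 1` leave out the ends of the edge. -/
def centralEdgeOK (g N a b ka kb : ℕ) : Bool :=
  edgeOK (levelLB g (pathEigLB N)) N N (a - 1) (b - 1) ka kb ||
    vertexOK (levelLB g (pathEigLB b)) N (a - 1) ka ||
    vertexOK (levelLB g (pathEigLB a)) N (b - 1) kb

/-- The pairs `(n, N)` that need neither the vertex nor the edge criterion. -/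
def trivialPair (n N : ℕ) : Bool :=
  decide (n ≤ 15) && (N == 1 || decide (goalUB n ≤ smallEigLB n + pathEigLB N))

/-- These sizes are left to `goalUB_le_of_exceptional`, which distinguishes the degrees at the edge
and uses a sharper bound for the second eigenvalue. -/
def exceptional (N a b : ℕ) : Bool :=
  [(4, 9, 7), (4, 8, 8), (4, 9, 8), (4, 9, 9), (5, 10, 6), (5, 11, 6)].contains (N, a, b)

def tableOK (n N : ℕ) : Bool :=
  trivialPair n N ||
    (vertexOK (levelLB (goalUB n) (pathEigLB N)) N (n - 1) (ceilQuot (n - 1) N) &&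
      (List.range (n / 2 - N)).all fun i =>
        let b := N + 1 + i
        let a := n - b
        exceptional N a b ||
          centralEdgeOK (goalUB n) N a b (ceilQuot (a - 1) N) (ceilQuot (b - 1) N))

lemma tableOK_small : ∀ n < 16, 4 ≤ n → ∀ N < 8, 1 ≤ N → 2 * N + 1 ≤ n → tableOK n N = true := by
  decide +kernel

lemma tableOK_medium : ∀ n < 43, 16 ≤ n → ∀ N < 7, 1 ≤ N → tableOK n N = true := by
  decide +kernel

end Tables

/-! ### Small levels `N`, by the tables -/

section SmallLevel

variable {V : Type*} [Fintype V] {G : SimpleGraph V}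

lemma le_levelLB_add (g m : ℕ) : g ≤ levelLB g m + m := by
  rw [levelLB]
  omega

lemma ceilQuot_le_card {ι : Type*} {W : Finset ι} {c : ι → ℕ} {S N : ℕ} (hN : 1 ≤ N)
    (hS : S ≤ ∑ w ∈ W, min (c w) N) : ceilQuot S N ≤ W.card :=
  ceilQuot_le hN (hS.trans (Finset.sum_le_card_nsmul _ _ _ fun _ _ => min_le_right _ _))

lemma pathEigLB_le_adjEigenvalues_one (hG : G.IsTree) (h : 1 < Fintype.card V) {N : ℕ}
    (hN : 1 ≤ N) (hc : ∃ z w w', G.Adj z w ∧ G.Adj z w' ∧ w ≠ w' ∧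
      N ≤ (branch G z w).card ∧ N ≤ (branch G z w').card) :
    (pathEigLB N : ℝ) / 60000 ≤ adjEigenvalues G ⟨1, h⟩ := by
  obtain ⟨z, w, w', hw, hw', hne, h1, h2⟩ := hc
  obtain ⟨j, hj, hj'⟩ := pathSeq_pathEigLB hN
  exact le_adjEigenvalues_one_of_branches hG h hw hw' hne (hj.trans h1) (hj.trans h2) hj'

lemma le_spectralSum_of_vertex (hG : G.IsTree) (h : 2 ≤ Fintype.card V) [DecidableRel G.Adj]
    (z : V) {g m N S : ℕ} (hN : 1 ≤ N)
    (h1 : (m : ℝ) / 60000 ≤ adjEigenvalues G ⟨1, by omega⟩)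
    (hS : S ≤ ∑ w ∈ G.neighborFinset z, min (branch G z w).card N)
    (hok : vertexOK (levelLB g m) N S (ceilQuot S N) = true) :
    (g : ℝ) / 60000 ≤ spectralSum G :=
  le_spectralSum_of_le h (le_levelLB_add g m)
    (le_adjEigenvalues_zero_of_vertex hG (by omega) z (le_max_left _ _) hN
      (ceilQuot_le_card hN hS) hS hok) h1

lemma sum_branch_erase (hG : G.IsTree) [DecidableEq V] [DecidableRel G.Adj] {u w : V}
    (huw : G.Adj u w) {N : ℕ} (hN : ∀ y, G.Adj u y → y ≠ w → (branch G u y).card ≤ N) :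
    ∑ y ∈ (G.neighborFinset u).erase w, min (branch G u y).card N
      = (branch G w u).card - 1 := by
  rw [card_branch hG huw.symm, Nat.add_sub_cancel_left]
  refine Finset.sum_congr rfl fun y hy => min_eq_left ?_
  rw [Finset.mem_erase, SimpleGraph.mem_neighborFinset] at hy
  exact hN y hy.2 hy.1

lemma goalUB_le_of_edgeOK (hG : G.IsTree) (h : 2 ≤ Fintype.card V)
    [DecidableEq V] [DecidableRel G.Adj] {u w : V} (huw : G.Adj u w) {g m Na Nb a b ka kb : ℕ}
    (hNa : 1 ≤ Na) (hNb : 1 ≤ Nb) (h1 : (m : ℝ) / 60000 ≤ adjEigenvalues G ⟨1, by omega⟩)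
    (hka : ka ≤ ((G.neighborFinset u).erase w).card)
    (hkb : kb ≤ ((G.neighborFinset w).erase u).card)
    (ha : (branch G w u).card - 1 = a) (hb : (branch G u w).card - 1 = b)
    (hu : ∀ y, G.Adj u y → y ≠ w → (branch G u y).card ≤ Na)
    (hw : ∀ y, G.Adj w y → y ≠ u → (branch G w y).card ≤ Nb)
    (hok : edgeOK (levelLB g m) Na Nb a b ka kb = true) : (g : ℝ) / 60000 ≤ spectralSum G :=
  le_spectralSum_of_le h (le_levelLB_add g m)
    (le_adjEigenvalues_zero_of_edge hG (by omega) huw (le_max_left _ _) hNa hNb hka hkb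
      (by rw [sum_branch_erase hG huw hu, ha]) (by rw [sum_branch_erase hG huw.symm hw, hb]) hok) h1

/-- The number 100950 is 120000 cos(2π/11) rounded down, from the second eigenvalue of the path on
10 vertices; likewise 106254 in `edgeOK_five` belongs to the path on 12 vertices. -/
lemma edgeOK_four : ∀ p ∈ [(9, 7), (8, 8), (9, 8), (9, 9)],
    edgeOK (levelLB (goalUB (p.1 + p.2)) (pathEigLB 4)) 4 4 (p.1 - 1) (p.2 - 1) 3 2 = true ∧
    edgeOK (levelLB (goalUB (p.1 + p.2)) (pathEigLB 4)) 4 4 (p.1 - 1) (p.2 - 1) 2 3 = true ∧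
    edgeOK (levelLB (goalUB (p.1 + p.2)) 100950) 4 4 (p.1 - 1) (p.2 - 1) 2 2 = true := by
  decide +kernel

lemma edgeOK_four_three : edgeOK (levelLB (goalUB 16) (pathEigLB 4)) 4 3 8 6 2 2 = true := by
  decide +kernel

lemma edgeOK_five : ∀ p ∈ [(10, 6), (11, 6)],
    edgeOK (levelLB (goalUB (p.1 + p.2)) (pathEigLB 5)) 5 5 (p.1 - 1) (p.2 - 1) 3 1 = true ∧
    edgeOK (levelLB (goalUB (p.1 + p.2)) (pathEigLB 5)) 5 5 (p.1 - 1) (p.2 - 1) 2 2 = true ∧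
    edgeOK (levelLB (goalUB (p.1 + p.2)) 106254) 5 5 (p.1 - 1) (p.2 - 1) 2 1 = true := by
  decide +kernel

/-- Among two numbers bounded by `N` one equals `N` as soon as their sum exceeds `2 (N - 1)`. -/
lemma exists_branch_card_eq (hG : G.IsTree) [DecidableEq V] [DecidableRel G.Adj] {u w : V}
    (huw : G.Adj u w) {N k : ℕ} (hk : ((G.neighborFinset u).erase w).card ≤ k)
    (hN : ∀ y, G.Adj u y → y ≠ w → (branch G u y).card ≤ N)
    (ha : k * (N - 1) < (branch G w u).card - 1) :
    ∃ y, G.Adj u y ∧ y ≠ w ∧ N ≤ (branch G u y).card := by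
  by_contra hc
  push Not at hc
  have h1 := sum_branch_erase hG huw hN
  have h2 : ∑ y ∈ (G.neighborFinset u).erase w, min (branch G u y).card N
      ≤ ((G.neighborFinset u).erase w).card * (N - 1) := by
    refine Finset.sum_le_card_nsmul _ _ _ fun y hy => ?_
    rw [Finset.mem_erase, SimpleGraph.mem_neighborFinset] at hy
    have := hc y hy.2 hy.1
    have := min_le_left (branch G u y).card N
    omega
  have h3 := Nat.mul_le_mul_right (N - 1) hk
  omega

lemma goalUB_le_of_exceptional (hG : G.IsTree) (h : 2 ≤ Fintype.card V) {N : ℕ}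
    (h1 : (pathEigLB N : ℝ) / 60000 ≤ adjEigenvalues G ⟨1, by omega⟩) {u w : V}
    (huw : G.Adj u w)
    (hu : ∀ y, G.Adj u y → y ≠ w → (branch G u y).card ≤ N)
    (hw : ∀ y, G.Adj w y → y ≠ u → (branch G w y).card ≤ N)
    (hex : exceptional N (branch G w u).card (branch G u w).card = true) :
    (goalUB (Fintype.card V) : ℝ) / 60000 ≤ spectralSum G := by
  classical
  have hab := card_branch_add_card_branch hG huw
  set a := (branch G w u).card with ha
  set b := (branch G u w).card with hb
  have sa := sum_branch_erase hG huw hu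
  have sb := sum_branch_erase hG huw.symm hw
  rw [← ha] at sa
  rw [← hb] at sb
  have cases : (N = 4 ∧ (a, b) ∈ [(9, 7), (8, 8), (9, 8), (9, 9)]) ∨
      (N = 5 ∧ (a, b) ∈ [(10, 6), (11, 6)]) := by
    simp only [exceptional, List.contains_eq_mem, List.mem_cons, Prod.mk.injEq, List.not_mem_nil,
      or_false, decide_eq_true_eq] at hex
    simp only [List.mem_cons, Prod.mk.injEq, List.not_mem_nil, or_false]
    omega
  rcases cases with ⟨rfl, hmem⟩ | ⟨rfl, hmem⟩
  · obtain ⟨e1, e2, e3⟩ := edgeOK_four _ hmem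
    simp only at e1 e2 e3
    rw [hab] at e1 e2 e3
    have hrange : 7 ≤ a - 1 ∧ 6 ≤ b - 1 ∧ (b - 1 = 6 → a = 9) := by
      simp only [List.mem_cons, Prod.mk.injEq, List.not_mem_nil, or_false] at hmem
      omega
    have ka : 2 ≤ ((G.neighborFinset u).erase w).card :=
      (by decide : 2 ≤ ceilQuot 7 4).trans
        (ceilQuot_le_card (by norm_num) (hrange.1.trans_eq sa.symm))
    have kb : 2 ≤ ((G.neighborFinset w).erase u).card :=
      (by decide : 2 ≤ ceilQuot 6 4).trans
        (ceilQuot_le_card (by norm_num) (hrange.2.1.trans_eq sb.symm))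
    by_cases ka3 : 3 ≤ ((G.neighborFinset u).erase w).card
    · exact goalUB_le_of_edgeOK hG h huw (by norm_num) (by norm_num) h1 ka3 kb rfl rfl hu hw e1
    by_cases kb3 : 3 ≤ ((G.neighborFinset w).erase u).card
    · exact goalUB_le_of_edgeOK hG h huw (by norm_num) (by norm_num) h1 ka kb3 rfl rfl hu hw e2
    obtain ⟨y, hy, hyw, hy4⟩ := exists_branch_card_eq hG huw (k := 2) (by omega) hu
      (by rw [← ha]; omega)
    by_cases hex : ∃ y', G.Adj w y' ∧ y' ≠ u ∧ 4 ≤ (branch G w y').card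
    · obtain ⟨y', hy', hyu', hy4'⟩ := hex
      refine goalUB_le_of_edgeOK hG h huw (by norm_num) (by norm_num) (m := 100950) ?_ ka kb rfl rfl
        hu hw e3
      refine le_adjEigenvalues_one_of_adj hG (by omega) huw hy hy' hyw hyu' hy4 hy4' ?_
      norm_num [pathSeq]
    · push Not at hex
      -- Two branches at `w` with at most three vertices each hold at most six vertices.
      have hb6 : b - 1 = 6 := by
        by_contra hne
        obtain ⟨y', hy', hyu', hy4'⟩ := exists_branch_card_eq hG huw.symm (k := 2) (by omega) hw
          (by rw [← hb]; omega)
        exact absurd hy4' (not_le.mpr (hex y' hy' hyu'))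
      have ha9 := hrange.2.2 hb6
      have hn : Fintype.card V = 16 := by omega
      rw [hn]
      exact goalUB_le_of_edgeOK hG h huw (by norm_num) (by norm_num) h1 ka kb
        (by rw [← ha, ha9]) (by rw [← hb, hb6]) hu
        (fun y' h1 h2 => Nat.le_of_lt_succ (hex y' h1 h2)) edgeOK_four_three
  · obtain ⟨e1, e2, e3⟩ := edgeOK_five _ hmem
    simp only at e1 e2 e3
    rw [hab] at e1 e2 e3
    have hrange : 9 ≤ a - 1 ∧ b - 1 = 5 := by
      simp only [List.mem_cons, Prod.mk.injEq, List.not_mem_nil, or_false] at hmem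
      omega
    have ka : 2 ≤ ((G.neighborFinset u).erase w).card :=
      (by decide : 2 ≤ ceilQuot 9 5).trans
        (ceilQuot_le_card (by norm_num) (hrange.1.trans_eq sa.symm))
    have kb : 1 ≤ ((G.neighborFinset w).erase u).card :=
      (by decide : 1 ≤ ceilQuot 5 5).trans
        (ceilQuot_le_card (by norm_num) (hrange.2.ge.trans_eq sb.symm))
    by_cases ka3 : 3 ≤ ((G.neighborFinset u).erase w).card
    · exact goalUB_le_of_edgeOK hG h huw (by norm_num) (by norm_num) h1 ka3 kb rfl rfl hu hw e1
    by_cases kb3 : 2 ≤ ((G.neighborFinset w).erase u).card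
    · exact goalUB_le_of_edgeOK hG h huw (by norm_num) (by norm_num) h1 ka kb3 rfl rfl hu hw e2
    obtain ⟨y, hy, hyw, hy4⟩ := exists_branch_card_eq hG huw (k := 2) (by omega) hu
      (by rw [← ha]; omega)
    obtain ⟨y', hy', hyu', hy4'⟩ := exists_branch_card_eq hG huw.symm (k := 1) (by omega) hw
      (by rw [← hb]; omega)
    refine goalUB_le_of_edgeOK hG h huw (by norm_num) (by norm_num) (m := 106254) ?_ ka kb rfl rfl
      hu hw e3
    refine le_adjEigenvalues_one_of_adj hG (by omega) huw hy hy' hyw hyu' hy4 hy4' ?_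
    norm_num [pathSeq]

/-- The tabulated criteria imply the bound, both for a central vertex and a central edge. -/
lemma goalUB_le_of_tableOK (hG : G.IsTree) (h : 2 ≤ Fintype.card V) {N : ℕ} (hN : 1 ≤ N)
    (h1 : (pathEigLB N : ℝ) / 60000 ≤ adjEigenvalues G ⟨1, by omega⟩)
    (hcenter : (∃ z, ∀ w, G.Adj z w → (branch G z w).card ≤ N) ∨
        ∃ u w, G.Adj u w ∧ N + 1 ≤ (branch G u w).card ∧
          (branch G u w).card ≤ (branch G w u).card ∧
          (∀ y, G.Adj u y → y ≠ w → (branch G u y).card ≤ N) ∧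
          (∀ y, G.Adj w y → y ≠ u → (branch G w y).card ≤ N))
    (htab : tableOK (Fintype.card V) N = true) (htriv : trivialPair (Fintype.card V) N ≠ true) :
    (goalUB (Fintype.card V) : ℝ) / 60000 ≤ spectralSum G := by
  classical
  simp only [tableOK, Bool.or_eq_true, Bool.and_eq_true, List.all_eq_true, List.mem_range] at htab
  obtain ⟨hvert, hedge⟩ := htab.resolve_left htriv
  rcases hcenter with ⟨z, hz⟩ | ⟨u, w, huw, hb1, hba, hu, hw⟩
  · refine le_spectralSum_of_vertex hG h z hN h1 (le_of_eq ?_) hvert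
    have := card_eq_one_add_sum_branch hG z
    rw [Finset.sum_congr rfl fun w hw => min_eq_left (hz w (by simpa using hw))]
    omega
  · have hab := card_branch_add_card_branch hG huw
    have hi := hedge ((branch G u w).card - (N + 1)) (by omega)
    have e1 : N + 1 + ((branch G u w).card - (N + 1)) = (branch G u w).card := by omega
    have e2 : Fintype.card V - (branch G u w).card = (branch G w u).card := by omega
    rw [e1, e2] at hi
    rcases hi with hi | hi
    · exact goalUB_le_of_exceptional hG h h1 huw hu hw hi
    · have ka := ceilQuot_le_card hN (sum_branch_erase hG huw hu).ge
      have kb := ceilQuot_le_card hN (sum_branch_erase hG huw.symm hw).ge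
      simp only [centralEdgeOK, Bool.or_eq_true] at hi
      rcases hi with (hi | hi) | hi
      · exact goalUB_le_of_edgeOK hG h huw hN hN h1 ka kb rfl rfl hu hw hi
      · exact le_spectralSum_of_split hG h huw (le_max_left _ _) hN (le_levelLB_add _ _) ka
          (sum_branch_erase hG huw hu).ge (by omega) le_rfl hi
      · exact le_spectralSum_of_split hG h huw.symm (le_max_left _ _) hN (le_levelLB_add _ _) kb
          (sum_branch_erase hG huw.symm hw).ge (by omega) le_rfl hi

lemma vertexOK_large : ∀ N < 7, 1 ≤ N →
    vertexOK (levelLB 240000 (pathEigLB N)) N 21 (ceilQuot 21 N) = true := by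
  decide +kernel

/-- The bound for trees with at least `16` vertices in which no vertex has two branches with more
than six vertices. -/
lemma goalUB_le_of_level_le_six (hG : G.IsTree) (hn : 16 ≤ Fintype.card V) {N : ℕ}
    (hN : 1 ≤ N) (hN6 : N ≤ 6)
    (h1 : (pathEigLB N : ℝ) / 60000 ≤ adjEigenvalues G ⟨1, by omega⟩)
    (hcenter : (∃ z, ∀ w, G.Adj z w → (branch G z w).card ≤ N) ∨
        ∃ u w, G.Adj u w ∧ N + 1 ≤ (branch G u w).card ∧
          (branch G u w).card ≤ (branch G w u).card ∧
          (∀ y, G.Adj u y → y ≠ w → (branch G u y).card ≤ N) ∧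
          (∀ y, G.Adj w y → y ≠ u → (branch G w y).card ≤ N)) :
    (goalUB (Fintype.card V) : ℝ) / 60000 ≤ spectralSum G := by
  classical
  by_cases h43 : Fintype.card V < 43
  · refine goalUB_le_of_tableOK hG (by omega) hN h1 hcenter
      (tableOK_medium _ h43 hn N (by omega) hN) ?_
    simp [trivialPair]
    omega
  · have hgoal : goalUB (Fintype.card V) = 240000 := by
      rw [goalUB, if_neg (by omega)]
    rw [hgoal]
    -- At a central edge the larger side has at least 22 of the at least 43 vertices, hence 21
    -- besides `u`. This already forces spectral sum at least 4.
    obtain ⟨v, hv⟩ : ∃ v, 21 ≤ ∑ w ∈ G.neighborFinset v, min (branch G v w).card N := by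
      rcases hcenter with ⟨z, hz⟩ | ⟨u, w, huw, hb1, hba, hu, hw⟩
      · refine ⟨z, ?_⟩
        have := card_eq_one_add_sum_branch hG z
        rw [Finset.sum_congr rfl fun w hw => min_eq_left (hz w (by simpa using hw))]
        omega
      · refine ⟨u, ?_⟩
        have hab := card_branch_add_card_branch hG huw
        refine le_trans ?_ (Finset.sum_le_sum_of_subset (Finset.erase_subset w _))
        rw [sum_branch_erase hG huw hu]
        omega
    exact le_spectralSum_of_vertex hG (by omega) v hN h1 hv (vertexOK_large N (by omega) hN)

lemma smallEigLB_le (hG : G.IsTree) (h4 : 4 ≤ Fintype.card V) (h15 : Fintype.card V ≤ 15) :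
    (smallEigLB (Fintype.card V) : ℝ) / 60000 ≤ adjEigenvalues G ⟨0, by omega⟩ := by
  refine (formBound_univ hG le_rfl ?_).le_adjEigenvalues_zero (by omega)
  generalize Fintype.card V = n at h4 h15 ⊢
  interval_cases n <;> norm_num [smallEigLB, pathSeq]

end SmallLevel

/-! ### Orders from 4 to 15 -/

section SmallOrder

variable {V : Type*} [Fintype V] {G : SimpleGraph V}

lemma sqrt_lt_goalUB {n : ℕ} (h4 : 4 ≤ n) (h15 : n ≤ 15) :
    √((n - 1 : ℕ) : ℝ) < (goalUB n : ℝ) / 60000 := by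
  rw [Real.sqrt_lt' (by interval_cases n <;> norm_num [goalUB])]
  interval_cases n <;> norm_num [goalUB]

/-- If all branches at `u` except the one towards `w` are single vertices, then `u` together with
them forms a star. -/
lemma formBound_sqrt (hG : G.IsTree) {u w : V} (huw : G.Adj u w)
    (hu : ∀ y, G.Adj u y → y ≠ w → (branch G u y).card ≤ 1) (h2 : 2 ≤ (branch G w u).card) :
    FormBound G (branch G w u) 0 √(((branch G w u).card - 1 : ℕ) : ℝ) := by
  classical
  set a := (branch G w u).card with ha
  set L := √((a - 1 : ℕ) : ℝ)
  have hone : ∀ y ∈ (G.neighborFinset u).erase w, (branch G u y).card = 1 := by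
    intro y hy
    rw [Finset.mem_erase, SimpleGraph.mem_neighborFinset] at hy
    exact le_antisymm (hu y hy.2 hy.1) (one_le_card_branch hy.2)
  have hcard : ((G.neighborFinset u).erase w).card = a - 1 := by
    have := card_branch hG huw.symm
    rw [← ha, Finset.sum_congr rfl hone] at this
    simp at this ⊢
    omega
  have hroot := formBound_or_sum_pathRatio_lt hG u (Finset.erase_subset w (G.neighborFinset u)) 0
    (fun _ _ => rfl) L
  rw [branch_eq_insert hG huw.symm] at hroot
  refine hroot.resolve_right ?_
  rintro ⟨-, hlt⟩
  rw [Finset.sum_congr rfl (fun y hy => by rw [hone y hy]), Finset.sum_const, hcard, nsmul_eq_mul,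
    Pi.zero_apply, add_zero] at hlt
  have hL : 0 < L := Real.sqrt_pos.mpr (by exact_mod_cast (by omega : 0 < a - 1))
  have hsq : L * L = ((a - 1 : ℕ) : ℝ) := Real.mul_self_sqrt (Nat.cast_nonneg _)
  have hr : pathRatio L 1 = 1 / L := by simp [pathRatio, pathSeq]
  rw [hr, ← hsq, mul_one_div, mul_div_cancel_right₀ _ hL.ne'] at hlt
  exact lt_irrefl _ hlt

/-- The tree is a double star. Its halves are stars with `p` and `q` leaves, and (√p + √q)² ≥ p + q
+ 2 exceeds n - 1 = p + q + 1. -/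
lemma sqrt_lt_spectralSum_of_edge (hG : G.IsTree) (h : 2 ≤ Fintype.card V) {u w : V}
    (huw : G.Adj u w) (hu : ∀ y, G.Adj u y → y ≠ w → (branch G u y).card ≤ 1)
    (hw : ∀ y, G.Adj w y → y ≠ u → (branch G w y).card ≤ 1)
    (ha : 2 ≤ (branch G w u).card) (hb : 2 ≤ (branch G u w).card) :
    √((Fintype.card V - 1 : ℕ) : ℝ) < spectralSum G := by
  refine lt_of_lt_of_le ?_ ((formBound_sqrt hG huw hu ha).add_le_spectralSum h
    (formBound_sqrt hG huw.symm hw hb) (disjoint_branch_symm hG huw))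
  have hab := card_branch_add_card_branch hG huw
  have e : Fintype.card V - 1
      = ((branch G w u).card - 1) + ((branch G u w).card - 1) + 1 := by omega
  have p1 : 1 ≤ (branch G w u).card - 1 := by omega
  have q1 : 1 ≤ (branch G u w).card - 1 := by omega
  rw [e]
  generalize (branch G w u).card - 1 = p at p1
  generalize (branch G u w).card - 1 = q at q1
  have hp : (1 : ℝ) ≤ √(p : ℝ) := Real.one_le_sqrt.mpr (by exact_mod_cast p1)
  have hq : (1 : ℝ) ≤ √(q : ℝ) := Real.one_le_sqrt.mpr (by exact_mod_cast q1)
  rw [Real.sqrt_lt' (by linarith)]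
  push_cast
  nlinarith [Real.sq_sqrt (Nat.cast_nonneg (α := ℝ) p), Real.sq_sqrt (Nat.cast_nonneg (α := ℝ) q)]

lemma adj_of_card_branch_le_one (hG : G.IsTree) {z : V}
    (hz : ∀ w, G.Adj z w → (branch G z w).card ≤ 1) {x : V} (hx : x ≠ z) : G.Adj z x := by
  obtain ⟨w, hw, hxw⟩ := exists_adj_mem_branch hG.connected hx
  rwa [Finset.card_le_one.mp (hz w hw) x hxw w (self_mem_branch hw)]

lemma two_mul_add_one_le_card (hG : G.IsTree) {N : ℕ}
    (hc : ∃ z w w', G.Adj z w ∧ G.Adj z w' ∧ w ≠ w' ∧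
      N ≤ (branch G z w).card ∧ N ≤ (branch G z w').card) : 2 * N + 1 ≤ Fintype.card V := by
  classical
  obtain ⟨z, w, w', hw, hw', hne, b1, b2⟩ := hc
  have := card_eq_one_add_sum_branch hG z
  have := Finset.sum_le_sum_of_subset (f := fun w => (branch G z w).card)
    (show {w, w'} ⊆ G.neighborFinset z by
      intro y
      simp only [Finset.mem_insert, Finset.mem_singleton, SimpleGraph.mem_neighborFinset]
      rintro (rfl | rfl) <;> assumption)
  rw [Finset.sum_pair hne] at this
  omega

lemma sqrt_lt_spectralSum (hG : G.IsTree) (h4 : 4 ≤ Fintype.card V) (h15 : Fintype.card V ≤ 15)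
    (hstar : ¬∃ z, ∀ x, x ≠ z → G.Adj z x) :
    √((Fintype.card V - 1 : ℕ) : ℝ) < spectralSum G := by
  classical
  obtain ⟨N, hN, hc, hcenter⟩ := exists_center hG (by omega)
  have h1 := pathEigLB_le_adjEigenvalues_one hG (by omega) hN hc
  have hNn := two_mul_add_one_le_card hG hc
  have hgoal := sqrt_lt_goalUB h4 h15
  by_cases htriv : trivialPair (Fintype.card V) N = true
  · simp only [trivialPair, Bool.and_eq_true, Bool.or_eq_true, decide_eq_true_eq,
      beq_iff_eq] at htriv
    rcases htriv.2 with rfl | hle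
    · rcases hcenter with ⟨z, hz⟩ | ⟨u, w, huw, hb, hba, hu, hw⟩
      · exact absurd ⟨z, fun x hx => adj_of_card_branch_le_one hG hz hx⟩ hstar
      · exact sqrt_lt_spectralSum_of_edge hG (by omega) huw hu hw (by omega) (by omega)
    · exact hgoal.trans_le (le_spectralSum_of_le (by omega) hle (smallEigLB_le hG h4 h15) h1)
  · exact hgoal.trans_le (goalUB_le_of_tableOK hG (by omega) hN h1 hcenter
      (tableOK_small _ (by omega) h4 N (by omega) hN hNn) htriv)

end SmallOrder

/-! ### Trigonometric form and upper bounds for the path -/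

section Trig

open Real

lemma sin_ge_sub_cube {x : ℝ} (hx : 0 ≤ x) : x - x ^ 3 / 6 ≤ sin x := by
  have hd : ∀ y : ℝ, HasDerivAt (fun y => sin y - (y - y ^ 3 / 6)) (cos y - (1 - y ^ 2 / 2)) y := by
    intro y
    have := (hasDerivAt_sin y).sub ((hasDerivAt_id y).sub (((hasDerivAt_id y).pow 3).div_const 6))
    exact this.congr_deriv (by simp; ring)
  have := monotone_of_deriv_nonneg (f := fun y => sin y - (y - y ^ 3 / 6))
    (fun y => (hd y).differentiableAt) (fun y => by
      rw [(hd y).deriv]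
      linarith [one_sub_sq_div_two_le_cos (x := y)]) hx
  simp at this
  linarith

lemma cos_le_quartic {x : ℝ} (hx : 0 ≤ x) : cos x ≤ 1 - x ^ 2 / 2 + x ^ 4 / 24 := by
  have hd : ∀ y : ℝ, HasDerivAt (fun y => 1 - y ^ 2 / 2 + y ^ 4 / 24 - cos y)
      (sin y - (y - y ^ 3 / 6)) y := by
    intro y
    have := ((((hasDerivAt_const y (1 : ℝ)).sub (((hasDerivAt_id y).pow 2).div_const 2)).add
      (((hasDerivAt_id y).pow 4).div_const 24))).sub (hasDerivAt_cos y)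
    exact this.congr_deriv (by simp; ring)
  have := monotoneOn_of_deriv_nonneg (convex_Ici (0 : ℝ))
    (f := fun y => 1 - y ^ 2 / 2 + y ^ 4 / 24 - cos y)
    (fun y _ => (hd y).continuousAt.continuousWithinAt)
    (fun y _ => (hd y).differentiableAt.differentiableWithinAt) (fun y hy => by
      rw [(hd y).deriv]
      rw [interior_Ici, Set.mem_Ioi] at hy
      linarith [sin_ge_sub_cube hy.le]) (Set.self_mem_Ici) hx hx
  simp at this
  linarith

lemma pathSeq_two_mul_cos (φ : ℝ) (k : ℕ) : pathSeq (2 * cos φ) k * sin φ = sin (k * φ) := by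
  induction k using Nat.twoStepInduction with
  | zero => simp [pathSeq]
  | one => simp [pathSeq]
  | more k h1 h2 =>
    rw [pathSeq_add_two, sub_mul, mul_assoc, h1, h2]
    have e1 : ((k + 1 : ℕ) : ℝ) * φ = k * φ + φ := by push_cast; ring
    have e2 : ((k + 2 : ℕ) : ℝ) * φ = k * φ + φ + φ := by push_cast; ring
    rw [e1, e2, sin_add (k * φ + φ), sin_add, cos_add]
    linear_combination sin (k * φ) * sin_sq_add_cos_sq φ

lemma angle_pos (n : ℕ) : 0 < π / (n + 1) := div_pos pi_pos (by positivity)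

lemma pathSeq_two_mul_cos_eq_zero {N : ℕ} (hN : 1 ≤ N) :
    pathSeq (2 * cos (π / (N + 1))) (N + 1) = 0 := by
  have h := pathSeq_two_mul_cos (π / (N + 1)) (N + 1)
  have e : ((N + 1 : ℕ) : ℝ) * (π / (N + 1)) = π := by
    push_cast
    field_simp
  rw [e, sin_pi] at h
  refine (mul_eq_zero.mp h).resolve_right (sin_pos_of_pos_of_lt_pi (angle_pos N) ?_).ne'
  refine div_lt_self pi_pos ?_
  have : (1 : ℝ) ≤ N := by exact_mod_cast hN
  linarith

/-- The spectral sum of the path on `n` vertices. -/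
noncomputable def pathSum (n : ℕ) : ℝ := 2 * cos (π / (n + 1)) + 2 * cos (2 * (π / (n + 1)))

lemma pathSum_le (n : ℕ) :
    pathSum n ≤ 4 - 5 * (π ^ 2 / (n + 1) ^ 2) + 17 / 12 * (π ^ 2 / (n + 1) ^ 2) ^ 2 := by
  have h0 := (angle_pos n).le
  have h1 := cos_le_quartic h0
  have h2 := cos_le_quartic (mul_nonneg zero_le_two h0)
  have e : π ^ 2 / ((n : ℝ) + 1) ^ 2 = (π / (n + 1)) ^ 2 := by rw [div_pow]
  rw [pathSum, e]
  nlinarith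

lemma pi_sq_lt : π ^ 2 < 9.8697 := by
  have := pi_lt_d6
  have := pi_pos
  nlinarith

lemma lt_pi_sq : 9.8696 < π ^ 2 := by
  have := pi_gt_d6
  nlinarith

/-- Lowering the coefficient 5 to 4.94 absorbs the quartic term, as π²/17² ≤ 0.0342 and 17/12 ·
0.0342 < 0.06. -/
lemma pathSum_lt {n : ℕ} (hn : 16 ≤ n) : pathSum n < 4 - 4.94 * (π ^ 2 / (n + 1) ^ 2) := by
  have hn' : (17 : ℝ) ≤ n + 1 := by
    have : (16 : ℝ) ≤ n := by exact_mod_cast hn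
    linarith
  have h0 : 0 < π ^ 2 / ((n : ℝ) + 1) ^ 2 := by positivity
  have h1 : π ^ 2 / ((n : ℝ) + 1) ^ 2 ≤ 0.0342 := by
    rw [div_le_iff₀ (by positivity)]
    nlinarith [pi_sq_lt]
  have := pathSum_le n
  nlinarith

lemma pathSum_lt_goalUB {n : ℕ} (hn : 16 ≤ n) : pathSum n < (goalUB n : ℝ) / 60000 := by
  by_cases h : n ≤ 22
  · refine (pathSum_le n).trans_lt ?_
    have h1 := pi_sq_lt
    have h2 := lt_pi_sq
    have h3 : (π ^ 2) ^ 2 < 97.411 := by nlinarith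
    interval_cases n <;> norm_num [goalUB, div_pow] at * <;> linarith
  · have := pathSum_lt hn
    have h0 : 0 < π ^ 2 / ((n : ℝ) + 1) ^ 2 := by positivity
    rw [goalUB, if_neg h]
    norm_num
    linarith

end Trig

/-! ### The first eigenvalue in the presence of a branch vertex -/

section BranchVertex

open Real

/-- Moving vertices from the smaller of two path branches to the larger one decreases the sum of
the path ratios. -/
lemma pathRatio_one_add_le {L : ℝ} {a b : ℕ} (ha : 1 ≤ a) (hb : 1 ≤ b) (hpos : PathPos L (a + b))
    (hmono : ∀ i j, i ≤ j → j ≤ a + b → pathSeq L i ≤ pathSeq L j) :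
    pathRatio L 1 + pathRatio L (a + b - 1) ≤ pathRatio L a + pathRatio L b := by
  obtain ⟨a, rfl⟩ := Nat.exists_eq_add_of_le ha
  obtain ⟨b, rfl⟩ := Nat.exists_eq_add_of_le hb
  have p : ∀ k, k + 1 ≤ 1 + a + (1 + b) → 0 < pathSeq L (k + 1) := fun k hk =>
    hpos _ (by omega) hk
  -- The increments from 1 to `1 + a` and from `1 + b` to `1 + b + a` have the same numerator, and
  -- the second has larger denominators.
  have e1 := pathRatio_add_sub (p 1 (by omega)).ne' (p (1 + a) (by omega)).ne'
  have e2 := pathRatio_add_sub (p (1 + b) (by omega)).ne' (p (1 + b + a) (by omega)).ne'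
  have h1 := hmono (1 + 1) (1 + b + 1) (by omega) (by omega)
  have h2 := hmono (1 + a + 1) (1 + b + a + 1) (by omega) (by omega)
  have h3 : pathSeq L a / (pathSeq L (1 + b + 1) * pathSeq L (1 + b + a + 1))
      ≤ pathSeq L a / (pathSeq L (1 + 1) * pathSeq L (1 + a + 1)) := by
    have := p 1 (by omega)
    have := p (1 + a) (by omega)
    have := p (1 + b) (by omega)
    have := hpos.nonneg (k := a) (by omega)
    gcongr
  rw [show 1 + a + (1 + b) - 1 = 1 + b + a by omega]
  linarith

variable {V : Type*} [Fintype V] {G : SimpleGraph V}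

/-- A tree with a vertex of degree at least three has a large first eigenvalue. -/
lemma two_mul_cos_le_adjEigenvalues_zero (hG : G.IsTree) (h : 0 < Fintype.card V)
    [DecidableRel G.Adj] (v : V) (h3 : 3 ≤ (G.neighborFinset v).card) :
    2 * cos (π / (2 * ((Fintype.card V : ℝ) - 1))) ≤ adjEigenvalues G ⟨0, h⟩ := by
  classical
  -- The extremal tree is the Dynkin diagram D_n, with branches of sizes 1, 1 and n - 3 at one
  -- vertex.
  set ψ := π / (2 * ((Fintype.card V : ℝ) - 1)) with hψ
  refine ((formBound_univ_or hG v _).resolve_right ?_).le_adjEigenvalues_zero h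
  rintro ⟨hpos, hlt⟩
  set L := 2 * cos ψ with hL
  obtain ⟨w₁, h₁, w₂, h₂, w₃, h₃, h12, h13, h23⟩ := Finset.two_lt_card.mp h3
  have hc1 : ∀ w ∈ G.neighborFinset v, 1 ≤ (branch G v w).card := fun w hw =>
    one_le_card_branch (by simpa using hw)
  have m₂ : w₂ ∈ (G.neighborFinset v).erase w₁ := Finset.mem_erase.mpr ⟨h12.symm, h₂⟩
  set R := ((G.neighborFinset v).erase w₁).erase w₂ with hR
  have m₃ : w₃ ∈ R := Finset.mem_erase.mpr ⟨h23.symm, Finset.mem_erase.mpr ⟨h13.symm, h₃⟩⟩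
  have hRsub : R ⊆ G.neighborFinset v := (Finset.erase_subset _ _).trans (Finset.erase_subset _ _)
  have hcard := card_eq_one_add_sum_branch hG v
  rw [← Finset.add_sum_erase _ _ h₁, ← Finset.add_sum_erase _ _ m₂, ← hR] at hcard
  rw [← Finset.add_sum_erase _ _ h₁, ← Finset.add_sum_erase _ _ m₂, ← hR] at hlt
  have n₁ := (hpos w₁ h₁).ratio_nonneg le_rfl
  have n₂ := (hpos w₂ h₂).ratio_nonneg le_rfl
  have hmerge := (PathPos.merge_sum R _ (fun w hw => hpos w (hRsub hw)) (by linarith)).2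
  have hr : 1 ≤ ∑ w ∈ R, (branch G v w).card :=
    (hc1 w₃ h₃).trans (Finset.single_le_sum (f := fun w => (branch G v w).card)
      (fun _ _ => Nat.zero_le _) m₃)
  have ha := hc1 w₁ h₁
  have hb := hc1 w₂ h₂
  generalize ∑ w ∈ R, (branch G v w).card = r at hr hmerge hcard
  generalize (branch G v w₁).card = a at ha n₁ hcard hlt
  generalize (branch G v w₂).card = b at hb n₂ hcard hlt
  obtain ⟨m, hm⟩ : ∃ m, a + b + r = m + 2 := ⟨a + b + r - 2, by omega⟩
  have hcV : ((Fintype.card V : ℝ) - 1) = (m + 2 : ℕ) := by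
    rw [hcard, show 1 + (a + (b + r)) = m + 2 + 1 by omega]
    push_cast
    ring
  -- Up to the index `m + 2` the sines of `kψ` increase, which gives the monotonicity of `pathSeq`
  -- needed for moving vertices.
  have hangle : ((m + 2 : ℕ) : ℝ) * ψ = π / 2 := by
    rw [hψ, hcV]
    field_simp
  have hm1 : (1 : ℝ) ≤ m := by exact_mod_cast (by omega : 1 ≤ m)
  have hψ0 : 0 < ψ := by
    rw [hψ, hcV]
    positivity
  have hψ3 : 3 * ψ ≤ π / 2 := by
    rw [← hangle]
    push_cast
    nlinarith
  have hsin : 0 < sin ψ := sin_pos_of_pos_of_lt_pi hψ0 (by linarith)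
  have hle : ∀ k ≤ m + 2, (k : ℝ) * ψ ≤ π / 2 := fun k hk => by
    rw [← hangle]
    gcongr
  have hmono : ∀ i j, i ≤ j → j ≤ m + 2 → pathSeq L i ≤ pathSeq L j := by
    intro i j hij hj
    refine le_of_mul_le_mul_right ?_ hsin
    rw [pathSeq_two_mul_cos, pathSeq_two_mul_cos]
    refine sin_le_sin_of_le_of_le_pi_div_two ?_ (hle j hj) (by gcongr)
    have : 0 ≤ (i : ℝ) * ψ := by positivity
    linarith [pi_pos]
  have hP : PathPos L (m + 2) := by
    intro k hk hk'
    have := hmono 1 k hk hk'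
    rw [pathSeq_one] at this
    linarith
  -- Two moves take the sizes `a`, `b`, `r` to 1, 1, `m`, where by `e3` the sum of the ratios equals
  -- `L` exactly.
  have s1 := pathRatio_one_add_le hb hr (hP.mono (by omega))
    (fun i j hij hj => hmono i j hij (by omega))
  have s2 := pathRatio_one_add_le (a := a) (b := b + r - 1) ha (by omega) (hP.mono (by omega))
    (fun i j hij hj => hmono i j hij (by omega))
  rw [show a + (b + r - 1) - 1 = m by omega] at s2
  have hcos : 0 < cos ψ := cos_pos_of_mem_Ioo ⟨by linarith, by linarith⟩
  have e1 : pathRatio L 1 = 1 / (2 * cos ψ) := by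
    simp [pathRatio, pathSeq, hL]
  have e2 : pathRatio L m = cos (2 * ψ) / cos ψ := by
    rw [pathRatio, ← mul_div_mul_right _ _ hsin.ne', pathSeq_two_mul_cos, pathSeq_two_mul_cos,
      show (m : ℝ) * ψ = π / 2 - 2 * ψ by rw [← hangle]; push_cast; ring,
      show ((m + 1 : ℕ) : ℝ) * ψ = π / 2 - ψ by rw [← hangle]; push_cast; ring,
      sin_pi_div_two_sub, sin_pi_div_two_sub]
  have e3 : 1 / (2 * cos ψ) + (1 / (2 * cos ψ) + cos (2 * ψ) / cos ψ) = L := by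
    rw [cos_two_mul, hL]
    field_simp
    ring
  rw [e1] at s1 s2
  rw [e2] at s2
  linarith

lemma two_mul_cos_le_adjEigenvalues_one (hG : G.IsTree) (h : 1 < Fintype.card V) {N : ℕ}
    (hN : 1 ≤ N) (hc : ∃ z w w', G.Adj z w ∧ G.Adj z w' ∧ w ≠ w' ∧
      N ≤ (branch G z w).card ∧ N ≤ (branch G z w').card) :
    2 * cos (π / (N + 1)) ≤ adjEigenvalues G ⟨1, h⟩ := by
  obtain ⟨z, w, w', hw, hw', hne, h1, h2⟩ := hc
  exact le_adjEigenvalues_one_of_branches hG h hw hw' hne h1 h2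
    (pathSeq_two_mul_cos_eq_zero hN).le

end BranchVertex

/-! ### Levels `N ≥ 7`: analytic comparison -/

section LargeLevel

open Real

/-- Comparison of `pathSum n` with the bound obtained from the level `N` when `n + 1` is at most
`r` times `N + 1`. -/
lemma pathSum_lt_of_le {n N : ℕ} (hn : 16 ≤ n) (hN : 7 ≤ N) {r l : ℝ} (_ : 0 < r)
    (hle : (n : ℝ) + 1 ≤ r * (N + 1)) (hl0 : 2 ≤ l) (hl : (1 - 4.94 / r ^ 2) * 0.1543 ≤ l - 2) :
    pathSum n < l + 2 * cos (π / (N + 1)) := by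
  have h1 := pathSum_lt hn
  have h2 := one_sub_sq_div_two_le_cos (x := π / (N + 1))
  rw [div_pow] at h2
  have hN' : (8 : ℝ) ≤ N + 1 := by
    have : (7 : ℝ) ≤ N := by exact_mod_cast hN
    linarith
  set s := π ^ 2 / ((N : ℝ) + 1) ^ 2 with hs
  have hs0 : 0 < s := by positivity
  -- This is π²/64 rounded up, from `N + 1 ≥ 8`.
  have hs1 : s ≤ 0.1543 := by
    rw [hs, div_le_iff₀ (by positivity)]
    nlinarith [pi_sq_lt]
  have h3 : s / r ^ 2 ≤ π ^ 2 / ((n : ℝ) + 1) ^ 2 := by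
    rw [hs, div_div, ← mul_pow, mul_comm _ r]
    gcongr
  have h4 : (1 - 4.94 / r ^ 2) * s ≤ l - 2 := by
    rcases le_total 0 (1 - 4.94 / r ^ 2) with h | h
    · exact (mul_le_mul_of_nonneg_left hs1 h).trans hl
    · nlinarith
  have h5 : (1 - 4.94 / r ^ 2) * s = s - 4.94 * (s / r ^ 2) := by ring
  linarith

/-- The case of two branches with `N` vertices, possibly joined through an edge. -/
lemma pathSum_lt_two_mul_cos {n N : ℕ} (hn : 16 ≤ n) (h : n = 2 * N + 1 ∨ n = 2 * N + 2) :
    pathSum n < 2 * cos (π / (2 * ((n : ℝ) - 1))) + 2 * cos (π / (N + 1)) := by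
  have hn' : (16 : ℝ) ≤ n := by exact_mod_cast hn
  rcases h with h | h
  · have e : (N : ℝ) + 1 = (n + 1) / 2 := by
      rw [h]
      push_cast
      ring
    have e' : π / ((N : ℝ) + 1) = 2 * (π / (n + 1)) := by
      rw [e]
      field_simp
    rw [pathSum, e']
    have : cos (π / (n + 1)) < cos (π / (2 * ((n : ℝ) - 1))) := by
      refine cos_lt_cos_of_nonneg_of_le_pi ?_ ?_ ?_
      · have : (0 : ℝ) < n - 1 := by linarith
        positivity
      · exact div_le_self pi_pos.le (by linarith)
      · exact div_lt_div_of_pos_left pi_pos (by linarith) (by linarith)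
    linarith
  · have e : (N : ℝ) + 1 = n / 2 := by
      rw [h]
      push_cast
      ring
    have h1 := pathSum_lt hn
    have h2 := one_sub_sq_div_two_le_cos (x := π / (N + 1))
    have h3 := one_sub_sq_div_two_le_cos (x := π / (2 * ((n : ℝ) - 1)))
    have h4 : π ^ 2 / (4 * (n - 1 : ℝ) ^ 2) + 4 * π ^ 2 / n ^ 2
        ≤ 4.94 * (π ^ 2 / ((n : ℝ) + 1) ^ 2) := by
      -- The constants 0.3212 and 4.5157 come from the worst case n = 16; their sum stays below
      -- 4.94.
      have k1 : 1 / (4 * (n - 1 : ℝ) ^ 2) ≤ 0.3212 / ((n : ℝ) + 1) ^ 2 := by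
        rw [div_le_div_iff₀ (by nlinarith) (by positivity)]
        nlinarith
      have k2 : 4 / (n : ℝ) ^ 2 ≤ 4.5157 / ((n : ℝ) + 1) ^ 2 := by
        rw [div_le_div_iff₀ (by positivity) (by positivity)]
        nlinarith
      have : 0 ≤ π ^ 2 := by positivity
      calc _ = π ^ 2 * (1 / (4 * (n - 1 : ℝ) ^ 2) + 4 / (n : ℝ) ^ 2) := by ring
        _ ≤ π ^ 2 * (0.3212 / ((n : ℝ) + 1) ^ 2 + 4.5157 / ((n : ℝ) + 1) ^ 2) := by gcongr
        _ = (0.3212 + 4.5157) * (π ^ 2 / ((n : ℝ) + 1) ^ 2) := by ring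
        _ ≤ _ := by
          gcongr
          norm_num
    rw [e] at h2 ⊢
    have e2 : (π / ((n : ℝ) / 2)) ^ 2 = 4 * π ^ 2 / n ^ 2 := by
      field_simp
      ring
    have e3 : (π / (2 * ((n : ℝ) - 1))) ^ 2 = π ^ 2 / (4 * (n - 1 : ℝ) ^ 2) := by
      rw [div_pow, mul_pow]
      norm_num
    rw [e2] at h2
    rw [e3] at h3
    linarith

variable {V : Type*} [Fintype V] {G : SimpleGraph V}

/-- Two sizes above 3 and two further ones give 3 + 3 + 1 + 1; with a single size above 3 the others
still add up to 5. -/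
lemma eight_le_sum_min_three {ι : Type*} {W : Finset ι} {c : ι → ℕ} {S : ℕ} (hW : 4 ≤ W.card)
    (hc : ∀ w ∈ W, 1 ≤ c w) (hS : ∑ w ∈ W, c w = S) (h8 : 8 ≤ S) (hmax : ∀ w ∈ W, c w + 5 ≤ S) :
    8 ≤ ∑ w ∈ W, min (c w) 3 := by
  classical
  have hsmall : ∀ U ⊆ W, (∀ w ∈ U, c w ≤ 3) → ∑ w ∈ U, min (c w) 3 = ∑ w ∈ U, c w :=
    fun U _ hU3 => Finset.sum_congr rfl fun w hw => min_eq_left (hU3 w hw)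
  by_cases h1 : ∀ w ∈ W, c w ≤ 3
  · rw [hsmall W subset_rfl h1]
    omega
  push Not at h1
  obtain ⟨w₀, h₀, h₀'⟩ := h1
  rw [← Finset.add_sum_erase _ _ h₀] at hS ⊢
  have := hmax w₀ h₀
  by_cases h2 : ∀ w ∈ W.erase w₀, c w ≤ 3
  · rw [hsmall _ (Finset.erase_subset _ _) h2]
    omega
  push Not at h2
  obtain ⟨w₁, h₁, h₁'⟩ := h2
  rw [← Finset.add_sum_erase _ _ h₁]
  have h3 : 2 ≤ ((W.erase w₀).erase w₁).card := by
    rw [Finset.card_erase_of_mem h₁, Finset.card_erase_of_mem h₀]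
    omega
  have h4 : ((W.erase w₀).erase w₁).card ≤ ∑ w ∈ (W.erase w₀).erase w₁, min (c w) 3 := by
    rw [Finset.card_eq_sum_ones]
    exact Finset.sum_le_sum fun w hw => le_min
      (hc w (Finset.mem_of_mem_erase (Finset.mem_of_mem_erase hw))) (by norm_num)
  omega

lemma le_adjEigenvalues_zero_of_four_le (hG : G.IsTree) (h : 16 ≤ Fintype.card V)
    [DecidableRel G.Adj] (z : V) (h4 : 4 ≤ (G.neighborFinset z).card)
    (hmax : ∀ w, G.Adj z w → (branch G z w).card + 6 ≤ Fintype.card V) :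
    ((129600 : ℕ) : ℝ) / 60000 ≤ adjEigenvalues G ⟨0, by omega⟩ := by
  have hcard := card_eq_one_add_sum_branch hG z
  have hS := eight_le_sum_min_three h4
    (fun w hw => one_le_card_branch (G := G) (u := z) (by simpa using hw)) rfl (by omega)
    (fun w hw => by
      have := hmax w (by simpa using hw)
      omega)
  exact le_adjEigenvalues_zero_of_vertex hG (by omega) z (by norm_num) (by norm_num) h4 hS
    (by decide +kernel)

lemma pathSum_lt_spectralSum_of_level (h : 16 ≤ Fintype.card V) {N l : ℕ}
    (hN : 7 ≤ N) (h1 : 2 * cos (π / (N + 1)) ≤ adjEigenvalues G ⟨1, by omega⟩)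
    (h0 : (l : ℝ) / 60000 ≤ adjEigenvalues G ⟨0, by omega⟩) {r : ℝ} (hr : 0 < r)
    (hle : (Fintype.card V : ℝ) + 1 ≤ r * (N + 1)) (hl0 : 2 ≤ (l : ℝ) / 60000)
    (hl : (1 - 4.94 / r ^ 2) * 0.1543 ≤ (l : ℝ) / 60000 - 2) :
    pathSum (Fintype.card V) < spectralSum G := by
  rw [spectralSum_eq (by omega)]
  linarith [pathSum_lt_of_le h hN hr hle hl0 hl]

/-- Four branches give a first eigenvalue of at least 2.16, more than 2.1543, so the comparison
holds whatever the ratio of `n + 1` to `N + 1`. -/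
lemma pathSum_lt_of_four_le (hG : G.IsTree) (h : 16 ≤ Fintype.card V)
    [DecidableRel G.Adj] (z : V) (h4 : 4 ≤ (G.neighborFinset z).card)
    (hmax : ∀ w, G.Adj z w → (branch G z w).card + 6 ≤ Fintype.card V) {N : ℕ}
    (hN : 7 ≤ N) (h1 : 2 * cos (π / (N + 1)) ≤ adjEigenvalues G ⟨1, by omega⟩) :
    pathSum (Fintype.card V) < spectralSum G := by
  have hN' : (0 : ℝ) < N + 1 := by positivity
  refine pathSum_lt_spectralSum_of_level h hN h1
    (le_adjEigenvalues_zero_of_four_le hG h z h4 hmax)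
    (r := ((Fintype.card V : ℝ) + 1) / (N + 1)) (by positivity)
    (div_mul_cancel₀ _ hN'.ne').ge (by norm_num) ?_
  have : 0 ≤ 4.94 / (((Fintype.card V : ℝ) + 1) / (N + 1)) ^ 2 := by positivity
  norm_num at this ⊢
  linarith

lemma ratioLB_line_five : ∀ a, 2 ≤ a → a ≤ 5 → 33100 + 2170 * a ≤ ratioLB 124800 a := by
  intro a h2 h5
  interval_cases a <;> decide +kernel

/-- The case of a vertex with exactly three branches. -/
lemma pathSum_lt_of_three (hG : G.IsTree) (h : 16 ≤ Fintype.card V)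
    [DecidableRel G.Adj] (z : V) (h3 : (G.neighborFinset z).card = 3) {N : ℕ}
    (hN : 7 ≤ N) (hNn : 2 * N + 1 ≤ Fintype.card V)
    (h1 : 2 * cos (π / (N + 1)) ≤ adjEigenvalues G ⟨1, by omega⟩)
    (hmax : ∀ w, G.Adj z w → (branch G z w).card ≤ N + 1)
    (hmax' : ∀ w w', G.Adj z w → G.Adj z w' → w ≠ w' →
      (branch G z w).card + (branch G z w').card ≤ 2 * N + 1) :
    pathSum (Fintype.card V) < spectralSum G := by
  classical
  have hcard := card_eq_one_add_sum_branch hG z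
  have hc1 : ∀ w ∈ G.neighborFinset z, 1 ≤ (branch G z w).card := fun w hw =>
    one_le_card_branch (by simpa using hw)
  obtain ⟨w₁, w₂, w₃, h12, h13, h23, hW⟩ := Finset.card_eq_three.mp h3
  have hsum : ∀ f : V → ℕ, ∑ w ∈ G.neighborFinset z, f w = f w₁ + f w₂ + f w₃ := by
    intro f
    rw [hW, Finset.sum_insert (by simp [h12, h13]), Finset.sum_pair h23, add_assoc]
  have a₁ : G.Adj z w₁ := by rw [← SimpleGraph.mem_neighborFinset, hW]; simp
  have a₂ : G.Adj z w₂ := by rw [← SimpleGraph.mem_neighborFinset, hW]; simp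
  have a₃ : G.Adj z w₃ := by rw [← SimpleGraph.mem_neighborFinset, hW]; simp
  rw [hsum] at hcard
  have c₁ := one_le_card_branch a₁
  have c₂ := one_le_card_branch a₂
  have c₃ := one_le_card_branch a₃
  have d₁ := hmax _ a₁
  have d₂ := hmax _ a₂
  have d₃ := hmax _ a₃
  have d₁₂ := hmax' _ _ a₁ a₂ h12
  have d₁₃ := hmax' _ _ a₁ a₃ h13
  have d₂₃ := hmax' _ _ a₂ a₃ h23
  have hN' : (7 : ℝ) ≤ N := by exact_mod_cast hN
  -- Near 2N the level 2.02 suffices, with `r = 2.25`. Otherwise every branch has at least two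
  -- vertices, since the other two have at most `2N + 1` together, and the better line valid from
  -- size 2 gives level 2.08 for `r = 3`.
  by_cases hsmall : Fintype.card V ≤ 2 * N + 3
  · have hS : 9 ≤ ∑ w ∈ G.neighborFinset z, min (branch G z w).card 4 := by
      rw [hsum]
      omega
    refine pathSum_lt_spectralSum_of_level h hN h1 (l := 121200)
      (le_adjEigenvalues_zero_of_vertex hG (by omega) z (by norm_num) (by norm_num) h3.ge hS
        (by decide +kernel)) (r := 2.25) (by norm_num) ?_ (by norm_num) (by norm_num)
    have : (Fintype.card V : ℝ) ≤ 2 * N + 3 := by exact_mod_cast hsmall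
    linarith
  · have hS : 12 ≤ ∑ w ∈ G.neighborFinset z, min (branch G z w).card 5 := by
      rw [hsum]
      omega
    have hc2 : ∀ w ∈ G.neighborFinset z, 2 ≤ (branch G z w).card := by
      intro w hw
      rw [hW] at hw
      simp only [Finset.mem_insert, Finset.mem_singleton] at hw
      rcases hw with rfl | rfl | rfl <;> omega
    have hline := line_sum_le (l := 124800) (by norm_num) ratioLB_line_five (by norm_num) hc2
      h3.ge hS
    have h0 : ((124800 : ℕ) : ℝ) / 60000 ≤ adjEigenvalues G ⟨0, by omega⟩ := by
      refine ((formBound_univ_or hG z _).resolve_right fun hc => ?_).le_adjEigenvalues_zero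
        (by omega)
      have := hc.2
      norm_num at this hline
      linarith
    refine pathSum_lt_spectralSum_of_level h hN h1 h0 (r := 3) (by norm_num) ?_
      (by norm_num) (by norm_num)
    have : (Fintype.card V : ℝ) ≤ 3 * N + 2 := by
      exact_mod_cast (by omega : Fintype.card V ≤ 3 * N + 2)
    linarith

end LargeLevel

/-! ### Trees with a branch vertex on at least 16 vertices -/

section LargeOrder

open Real

variable {V : Type*} [Fintype V] {G : SimpleGraph V}

lemma card_branch_le_mul (hG : G.IsTree) [DecidableEq V] [DecidableRel G.Adj] {u w : V}
    (huw : G.Adj u w) {N : ℕ} (hu : ∀ y, G.Adj u y → y ≠ w → (branch G u y).card ≤ N) :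
    (branch G w u).card ≤ ((G.neighborFinset u).erase w).card * N + 1 := by
  rw [card_branch hG huw.symm, add_comm]
  refine Nat.add_le_add_right (Finset.sum_le_card_nsmul _ _ _ fun y hy => ?_) 1
  rw [Finset.mem_erase, SimpleGraph.mem_neighborFinset] at hy
  exact hu y hy.2 hy.1

/-- A tree of order at least `16` with a branch vertex has a larger spectral sum than the path. -/
lemma pathSum_lt_spectralSum (hG : G.IsTree) (h : 16 ≤ Fintype.card V)
    [DecidableRel G.Adj] (hdeg : ∃ v, 3 ≤ (G.neighborFinset v).card) :
    pathSum (Fintype.card V) < spectralSum G := by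
  classical
  obtain ⟨N, hN, hc, hcenter⟩ := exists_center hG (by omega)
  rcases Nat.lt_or_ge N 7 with hN7 | hN7
  · exact (pathSum_lt_goalUB h).trans_le (goalUB_le_of_level_le_six hG h hN (by omega)
      (pathEigLB_le_adjEigenvalues_one hG (by omega) hN hc) hcenter)
  have hNn := two_mul_add_one_le_card hG hc
  have h1 := two_mul_cos_le_adjEigenvalues_one hG (by omega) hN hc
  have hpair : Fintype.card V = 2 * N + 1 ∨ Fintype.card V = 2 * N + 2 →
      pathSum (Fintype.card V) < spectralSum G := by
    intro hn
    obtain ⟨v, hv⟩ := hdeg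
    rw [spectralSum_eq (by omega)]
    linarith [pathSum_lt_two_mul_cos h hn, two_mul_cos_le_adjEigenvalues_zero hG (by omega) v hv]
  rcases hcenter with ⟨z, hz⟩ | ⟨u, w, huw, hb1, hba, hu, hw⟩
  · have hcard := card_eq_one_add_sum_branch hG z
    have hle : ∑ w ∈ G.neighborFinset z, (branch G z w).card ≤ (G.neighborFinset z).card * N :=
      Finset.sum_le_card_nsmul _ _ _ fun w hw => hz w (by simpa using hw)
    have hdz : 2 ≤ (G.neighborFinset z).card := by
      by_contra hlt
      have := Nat.mul_le_mul_right N (show (G.neighborFinset z).card ≤ 1 by omega)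
      omega
    rcases Nat.lt_or_ge (G.neighborFinset z).card 4 with h4 | h4
    · rcases Nat.lt_or_ge (G.neighborFinset z).card 3 with h3 | h3
      · refine hpair (Or.inl ?_)
        rw [show (G.neighborFinset z).card = 2 by omega] at hle
        omega
      · refine pathSum_lt_of_three hG h z (by omega) hN7 hNn h1
          (fun w hw => (hz w hw).trans (Nat.le_succ N)) fun w w' hw hw' _ => ?_
        have := hz w hw
        have := hz w' hw'
        omega
    · refine pathSum_lt_of_four_le hG h z h4 (fun w hw => ?_) hN7 h1
      have := hz w hw
      omega
  · have hab := card_branch_add_card_branch hG huw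
    have ha := card_branch_le_mul hG huw hu
    have hb := card_branch_le_mul hG huw.symm hw
    have mw : w ∈ G.neighborFinset u := by simpa using huw
    have mu : u ∈ G.neighborFinset w := by simpa using huw.symm
    have du := Finset.card_erase_add_one mw
    have dw := Finset.card_erase_add_one mu
    set ka := ((G.neighborFinset u).erase w).card with hka
    set kb := ((G.neighborFinset w).erase u).card with hkb
    have four : ∀ v v' : V, G.Adj v v' → (branch G v v').card + 6 ≤ Fintype.card V →
        (∀ y, G.Adj v y → y ≠ v' → (branch G v y).card ≤ N) → 4 ≤ (G.neighborFinset v).card →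
        pathSum (Fintype.card V) < spectralSum G := by
      intro v v' _ hv' hv hd
      refine pathSum_lt_of_four_le hG h v hd (fun y hy => ?_) hN7 h1
      rcases eq_or_ne y v' with rfl | hne
      · exact hv'
      · have := hv y hy hne
        omega
    rcases Nat.lt_or_ge ka 3 with ka3 | ka3
    swap
    · exact four u w huw (by omega) hu (by omega)
    rcases Nat.lt_or_ge kb 3 with kb3 | kb3
    swap
    · exact four w u huw.symm (by omega) hw (by omega)
    have ka1 : 1 ≤ ka := by
      by_contra hlt
      rw [show ka = 0 by omega] at ha
      omega
    have kb1 : 1 ≤ kb := by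
      by_contra hlt
      rw [show kb = 0 by omega] at hb
      omega
    rcases (show ka = 1 ∨ ka = 2 by omega) with hka' | hka'
    · refine hpair (Or.inr ?_)
      rw [hka'] at ha
      omega
    rw [hka'] at ha
    rcases (show kb = 1 ∨ kb = 2 by omega) with hkb' | hkb'
    · rw [hkb'] at hb
      -- The branch at `u` through `w` may have `N + 1` vertices, hence the slack in the hypotheses
      -- of `pathSum_lt_of_three`.
      refine pathSum_lt_of_three hG h u (by omega) hN7 hNn h1 (fun y hy => ?_)
        fun y y' hy hy' hne => ?_
      · rcases eq_or_ne y w with rfl | hyw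
        · omega
        · exact (hu y hy hyw).trans (Nat.le_succ N)
      · rcases eq_or_ne y w with rfl | hyw
        · have := hu y' hy' hne.symm
          omega
        · have := hu y hy hyw
          rcases eq_or_ne y' w with rfl | hyw'
          · omega
          · have := hu y' hy' hyw'
            omega
    · rw [hkb'] at hb
      -- Both ends have degree three: two branches holding at least 7 vertices keep at least 6 after
      -- capping at 5. This yields level 2.13, enough for `r = 4`.
      have side : ∀ v v' : V, G.Adj v v' → 8 ≤ (branch G v' v).card →
          ((G.neighborFinset v).erase v').card = 2 →
          6 ≤ ∑ y ∈ (G.neighborFinset v).erase v', min (branch G v y).card 5 := by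
        intro v v' hv h8 h2
        have hcard := card_branch hG hv.symm
        obtain ⟨y, y', hne, hW⟩ := Finset.card_eq_two.mp h2
        have hy : y ∈ (G.neighborFinset v).erase v' := by simp [hW]
        have hy' : y' ∈ (G.neighborFinset v).erase v' := by simp [hW]
        have c := one_le_card_branch (G := G) (u := v) (w := y)
          (by simpa using Finset.mem_of_mem_erase hy)
        have c' := one_le_card_branch (G := G) (u := v) (w := y')
          (by simpa using Finset.mem_of_mem_erase hy')
        rw [hW, Finset.sum_pair hne] at hcard ⊢
        omega
      refine pathSum_lt_spectralSum_of_level h hN7 h1 (l := 127800)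
        (le_adjEigenvalues_zero_of_edge hG (by omega) huw (ka := 2) (kb := 2) (Na := 5) (Nb := 5)
          (a := 6) (b := 6) (by norm_num) (by norm_num) (by norm_num) hka'.ge hkb'.ge
          (side u w huw (by omega) hka') (side w u huw.symm (by omega) hkb') (by decide +kernel))
        (r := 4) (by norm_num) ?_ (by norm_num) (by norm_num)
      have : (Fintype.card V : ℝ) ≤ 4 * N + 2 := by
        exact_mod_cast (by omega : Fintype.card V ≤ 4 * N + 2)
      linarith

end LargeOrder

/-! ### Invariance of the spectral sum under isomorphism -/

section Iso

variable {V W : Type*} [Fintype V] [Fintype W] {G : SimpleGraph V} {H : SimpleGraph W}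

lemma ofFn_adjEigenvalues_eq (e : G ≃g H) :
    List.ofFn (adjEigenvalues G) = List.ofFn (adjEigenvalues H) := by
  classical
  unfold adjEigenvalues
  rw [← Matrix.IsHermitian.sort_roots_charpoly_eq_eigenvalues₀,
    ← Matrix.IsHermitian.sort_roots_charpoly_eq_eigenvalues₀, ← e.reindex_adjMatrix ℝ,
    Matrix.charpoly_reindex]

lemma spectralSum_eq_of_iso (e : G ≃g H) : spectralSum G = spectralSum H := by
  have hcard : Fintype.card V = Fintype.card W := Fintype.card_congr e.toEquiv
  have hlist := ofFn_adjEigenvalues_eq e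
  by_cases h : 2 ≤ Fintype.card V
  · have h' : 2 ≤ Fintype.card W := hcard ▸ h
    rw [spectralSum_eq h, spectralSum_eq h']
    have e0 := congrArg (fun l => l.getD 0 0) hlist
    have e1 := congrArg (fun l => l.getD 1 0) hlist
    simp only [List.getD_eq_getElem?_getD, List.getElem?_ofFn, show 0 < Fintype.card V by omega,
      show 0 < Fintype.card W by omega, show 1 < Fintype.card V by omega,
      show 1 < Fintype.card W by omega, dif_pos, Option.getD_some] at e0 e1
    rw [e0, e1]
  · rw [spectralSum, spectralSum, dif_neg h, dif_neg (hcard ▸ h)]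

end Iso

/-! ### The spectral sum of the path -/

section Path

open Real

/-- Writing x = 2cos φ puts φ strictly between consecutive multiples of π/(n+1), so sin((n+1)φ) ≠ 0.
-/
lemma pathSeq_ne_zero_of_mem {n j : ℕ} (hj : j ≤ n) {x : ℝ}
    (h1 : 2 * cos (((j : ℝ) + 1) * (π / (n + 1))) < x) (h2 : x < 2 * cos (j * (π / (n + 1)))) :
    pathSeq x (n + 1) ≠ 0 := by
  have hθ := angle_pos n
  have hnθ : ((n : ℝ) + 1) * (π / (n + 1)) = π := by field_simp
  have hjn : (j : ℝ) ≤ n := by exact_mod_cast hj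
  set θ := π / ((n : ℝ) + 1)
  have hφ : cos (arccos (x / 2)) = x / 2 :=
    cos_arccos (by linarith [neg_one_le_cos (((j : ℝ) + 1) * θ)])
      (by linarith [cos_le_one ((j : ℝ) * θ)])
  have k0 := arccos_nonneg (x / 2)
  have k1 := arccos_le_pi (x / 2)
  set φ := arccos (x / 2)
  have l1 : j * θ < φ := by
    by_contra hc
    have := cos_le_cos_of_nonneg_of_le_pi k0 (by nlinarith : (j : ℝ) * θ ≤ π) (not_lt.mp hc)
    linarith
  have l2 : φ < ((j : ℝ) + 1) * θ := by
    by_contra hc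
    have := cos_le_cos_of_nonneg_of_le_pi (by positivity) k1 (not_lt.mp hc)
    linarith
  intro h0
  have h3 := pathSeq_two_mul_cos φ (n + 1)
  rw [show 2 * cos φ = x by linarith, h0, zero_mul] at h3
  obtain ⟨m, hm⟩ := sin_eq_zero_iff.mp h3.symm
  push_cast at hm
  have hn0 : (0 : ℝ) < n + 1 := by positivity
  have m1 : (j : ℝ) * π < m * π := by
    rw [hm, ← hnθ]
    nlinarith
  have m2 : (m : ℝ) * π < ((j : ℝ) + 1) * π := by
    rw [hm, ← hnθ]
    nlinarith
  have m1' := lt_of_mul_lt_mul_right m1 pi_pos.le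
  have m2' := lt_of_mul_lt_mul_right m2 pi_pos.le
  have : (j : ℤ) < m := by exact_mod_cast m1'
  have : m < (j : ℤ) + 1 := by exact_mod_cast m2'
  omega

lemma le_two_mul_cos_of_pathSeq_eq_zero {n : ℕ} {x : ℝ} (h : pathSeq x (n + 1) = 0) :
    x ≤ 2 * cos (π / (n + 1)) := by
  by_contra hc
  push Not at hc
  have hx2 : x < 2 := by
    by_contra h2
    exact (pathPos_of_two_le (not_lt.mp h2) (n + 1) (n + 1) (by omega) le_rfl).ne' h
  exact pathSeq_ne_zero_of_mem (Nat.zero_le n) (by simpa using hc) (by simpa using hx2) h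

lemma le_two_mul_cos_two_of_pathSeq_eq_zero {n : ℕ} (hn : 1 ≤ n) {x : ℝ}
    (h : pathSeq x (n + 1) = 0) (hlt : x < 2 * cos (π / (n + 1))) :
    x ≤ 2 * cos (2 * (π / (n + 1))) := by
  by_contra hc
  push Not at hc
  refine pathSeq_ne_zero_of_mem hn ?_ (by simpa using hlt) h
  norm_num
  exact hc

/-- Extension of a weighting of `Fin n` by zero. -/
def extendZero {n : ℕ} (x : Fin n → ℝ) (k : ℕ) : ℝ := if h : k < n then x ⟨k, h⟩ else 0

lemma sum_ite_val_eq {n : ℕ} (x : Fin n → ℝ) (k : ℕ) :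
    ∑ w : Fin n, (if w.val = k then x w else 0) = extendZero x k := by
  rw [extendZero]
  split_ifs with h
  · rw [Finset.sum_eq_single ⟨k, h⟩]
    · simp
    · intro b _ hb
      rw [if_neg fun hc => hb (Fin.ext hc)]
    · simp
  · refine Finset.sum_eq_zero fun w _ => if_neg ?_
    have := w.isLt
    omega

lemma adjSum_pathGraph {n : ℕ} (x : Fin n → ℝ) (v : Fin n) :
    adjSum (SimpleGraph.pathGraph n) x v = extendZero x (v + 1)
      + ∑ w : Fin n, (if w.val + 1 = v.val then x w else 0) := by
  classical
  rw [adjSum, SimpleGraph.neighborFinset_eq_filter, Finset.sum_filter, ← sum_ite_val_eq,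
    ← Finset.sum_add_distrib]
  refine Finset.sum_congr rfl fun w _ => ?_
  simp only [SimpleGraph.pathGraph_adj]
  split_ifs <;> first | omega | simp

/-- The eigenvalue equation is the recursion of `pathSeq`. The case `k = n`, one step past the last
vertex, turns the zero extension into the condition `pathSeq μ (n + 1) = 0`. -/
lemma extendZero_eq_pathSeq_mul {n : ℕ} {x : Fin n → ℝ} {μ : ℝ}
    (hx : adjSum (SimpleGraph.pathGraph n) x = μ • x) (k : ℕ) (hk : k ≤ n) :
    extendZero x k = pathSeq μ (k + 1) * extendZero x 0 := by
  have hx' : ∀ v : Fin n, extendZero x (v + 1)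
      + ∑ w : Fin n, (if w.val + 1 = v.val then x w else 0) = μ * extendZero x v := by
    intro v
    rw [← adjSum_pathGraph, hx, extendZero, dif_pos v.isLt]
    rfl
  induction k using Nat.twoStepInduction with
  | zero => simp [pathSeq]
  | one =>
    have := hx' ⟨0, by omega⟩
    simpa [pathSeq] using this
  | more k h1 h2 =>
    have h3 := hx' ⟨k + 1, by omega⟩
    simp only [Nat.add_right_cancel_iff, sum_ite_val_eq] at h3
    rw [h1 (by omega), h2 (by omega)] at h3
    rw [pathSeq_add_two]
    linear_combination h3

lemma spectralSum_pathGraph_le {n : ℕ} (hn : 2 ≤ n) :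
    spectralSum (SimpleGraph.pathGraph n) ≤ pathSum n := by
  have hcard : Fintype.card (Fin n) = n := Fintype.card_fin n
  obtain ⟨b, he, horth, -, -⟩ := exists_eigenbasis (SimpleGraph.pathGraph n)
  have hb : ∀ i v, b i v = pathSeq (adjEigenvalues (SimpleGraph.pathGraph n) i) (v + 1)
      * extendZero (b i) 0 := by
    intro i v
    rw [← extendZero_eq_pathSeq_mul (he i) v v.isLt.le, extendZero, dif_pos v.isLt]
  have h0 : ∀ i, extendZero (b i) 0 ≠ 0 := by
    intro i hc
    have := horth i i
    simp [hb i, hc] at this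
  have hroot : ∀ i, pathSeq (adjEigenvalues (SimpleGraph.pathGraph n) i) (n + 1) = 0 := by
    intro i
    have := extendZero_eq_pathSeq_mul (he i) n le_rfl
    rw [extendZero, dif_neg (lt_irrefl n)] at this
    exact (mul_eq_zero.mp this.symm).resolve_right (h0 i)
  set i0 : Fin (Fintype.card (Fin n)) := ⟨0, by omega⟩ with hi0
  set i1 : Fin (Fintype.card (Fin n)) := ⟨1, by omega⟩ with hi1
  -- The eigenvalue and the first entry determine an eigenvector, so equal eigenvalues would give
  -- proportional eigenvectors, against orthogonality.
  have hne : adjEigenvalues (SimpleGraph.pathGraph n) i1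
      ≠ adjEigenvalues (SimpleGraph.pathGraph n) i0 := by
    intro heq
    have o1 := horth i0 i1
    have o0 := horth i0 i0
    rw [if_neg (by simp [hi0, hi1])] at o1
    rw [if_pos rfl] at o0
    have key : extendZero (b i1) 0 * ∑ v, b i0 v * b i0 v
        = extendZero (b i0) 0 * ∑ v, b i0 v * b i1 v := by
      rw [Finset.mul_sum, Finset.mul_sum]
      refine Finset.sum_congr rfl fun v _ => ?_
      rw [hb i1 v, heq, hb i0 v]
      ring
    rw [o1, o0, mul_one, mul_zero] at key
    exact h0 i1 key
  have hle : adjEigenvalues (SimpleGraph.pathGraph n) i1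
      ≤ adjEigenvalues (SimpleGraph.pathGraph n) i0 :=
    adjEigenvalues_antitone _ (by simp [hi0, hi1, Fin.le_def])
  have b0 := le_two_mul_cos_of_pathSeq_eq_zero (hroot i0)
  have b1 := le_two_mul_cos_two_of_pathSeq_eq_zero (by omega) (hroot i1)
    ((lt_of_le_of_ne hle hne).trans_le b0)
  rw [spectralSum_eq (by omega), pathSum]
  exact add_le_add b0 b1

end Path

/-! ### The star and its spectral sum -/

section Star

open SimpleGraph

variable {V : Type*}

lemma eq_starGraph {G : SimpleGraph V} (hG : G.IsTree) {z : V} (hz : ∀ x, x ≠ z → G.Adj z x) : G = starGraph z := by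
  ext x y
  rw [starGraph_adj]
  constructor
  · intro h
    refine ⟨h.ne, ?_⟩
    by_contra hc
    push Not at hc
    have h1 := dist_eq_one_iff_adj.mpr (hz x hc.1)
    have h2 := dist_eq_one_iff_adj.mpr (hz y hc.2)
    exact hG.dist_ne_of_adj z h (h1.trans h2.symm)
  · rintro ⟨hne, rfl | rfl⟩
    · exact hz y hne.symm
    · exact (hz x hne).symm

variable [Fintype V]

lemma adjForm_starGraph [DecidableEq V] (z : V) (x : V → ℝ) :
    adjForm (starGraph z) x = 2 * (x z * ∑ w ∈ Finset.univ.erase z, x w) := by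
  classical
  have h1 : adjSum (starGraph z) x z = ∑ w ∈ Finset.univ.erase z, x w := by
    refine Finset.sum_congr ?_ fun _ _ => rfl
    ext w
    simp [starGraph_adj, eq_comm]
  have h2 : ∀ v ∈ Finset.univ.erase z, adjSum (starGraph z) x v = x z := by
    intro v hv
    have hvz : v ≠ z := Finset.ne_of_mem_erase hv
    refine (Finset.sum_congr (s₂ := {z}) ?_ fun _ _ => rfl).trans (Finset.sum_singleton _ _)
    ext w
    rw [mem_neighborFinset, starGraph_adj, Finset.mem_singleton]
    constructor
    · rintro ⟨-, h | h⟩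
      · exact absurd h hvz
      · exact h
    · rintro rfl
      exact ⟨hvz, Or.inr rfl⟩
  have h3 : ∑ v ∈ Finset.univ.erase z, x v * adjSum (starGraph z) x v
      = ∑ v ∈ Finset.univ.erase z, x v * x z :=
    Finset.sum_congr rfl fun v hv => by rw [h2 v hv]
  rw [adjForm, ← Finset.add_sum_erase _ _ (Finset.mem_univ z), h1, h3, ← Finset.sum_mul]
  ring

lemma spectralSum_starGraph_le (h : 2 ≤ Fintype.card V) (z : V) :
    spectralSum (starGraph z) ≤ √((Fintype.card V - 1 : ℕ) : ℝ) := by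
  classical
  set M := √((Fintype.card V - 1 : ℕ) : ℝ) with hM
  have hM0 : 0 < M := Real.sqrt_pos.mpr (by exact_mod_cast (by omega : 0 < Fintype.card V - 1))
  have hM2 : M ^ 2 = ((Fintype.card V - 1 : ℕ) : ℝ) := Real.sq_sqrt (Nat.cast_nonneg _)
  rw [spectralSum_eq h]
  have h0 : adjEigenvalues (starGraph z) ⟨0, by omega⟩ ≤ M := by
    refine adjEigenvalues_zero_le _ _ fun x => ?_
    rw [adjForm_starGraph, ← Finset.add_sum_erase _ _ (Finset.mem_univ z)]
    have hcs := sq_sum_le_card_mul_sum_sq (s := Finset.univ.erase z) (f := x)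
    rw [Finset.card_erase_of_mem (Finset.mem_univ z), Finset.card_univ, ← hM2] at hcs
    set S := ∑ w ∈ Finset.univ.erase z, x w
    set Q := ∑ w ∈ Finset.univ.erase z, x w ^ 2
    refine le_of_mul_le_mul_left ?_ hM0
    -- This combines 2 M x_z S ≤ M² x_z² + S² with the Cauchy-Schwarz bound S² ≤ M² Q.
    nlinarith [sq_nonneg (M * x z - S)]
  have h1 : adjEigenvalues (starGraph z) ⟨1, by omega⟩ ≤ 0 :=
    adjEigenvalues_one_nonpos _ _ z fun x hx => by rw [adjForm_starGraph, hx]; simp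
  linarith

lemma nonempty_starGraph_iso (z : V) :
    Nonempty (starGraph z ≃g completeBipartiteGraph (Fin 1) (Fin (Fintype.card V - 1))) := by
  classical
  have c1 : Fintype.card {x // x = z} = 1 := by simp
  have c2 : Fintype.card {x // ¬x = z} = Fintype.card V - 1 := by
    rw [Fintype.card_subtype_compl, c1]
  let e : V ≃ Fin 1 ⊕ Fin (Fintype.card V - 1) := (Equiv.sumCompl (· = z)).symm.trans
    (Equiv.sumCongr (Fintype.equivFinOfCardEq c1) (Fintype.equivFinOfCardEq c2))
  have he : ∀ x, (e x).isLeft = decide (x = z) := by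
    intro x
    by_cases hx : x = z
    · simp [e, hx]
    · simp [e, hx]
  refine ⟨⟨e, fun {x y} => ?_⟩⟩
  have hr : ∀ s : Fin 1 ⊕ Fin (Fintype.card V - 1), s.isRight = !s.isLeft := by
    rintro (s | s) <;> rfl
  rw [completeBipartiteGraph_adj, starGraph_adj, hr, hr, he, he]
  simp only [decide_eq_true_eq, Bool.not_eq_true', decide_eq_false_iff_not]
  grind

end Star

/-! ### Recognizing paths by their degrees -/

section PathIso

open SimpleGraph

variable {V : Type*} [Fintype V] {G : SimpleGraph V}

/-- A tree with maximum degree at most two is a path. -/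
lemma nonempty_iso_pathGraph (hG : G.IsTree) [DecidableRel G.Adj]
    (hdeg : ∀ v, (G.neighborFinset v).card ≤ 2) :
    Nonempty (G ≃g pathGraph (Fintype.card V)) := by
  classical
  have hconn := hG.connected
  obtain ⟨l, hl⟩ : ∃ l, (G.neighborFinset l).card ≤ 1 := by
    rcases subsingleton_or_nontrivial V with hs | hs
    · obtain ⟨l⟩ := hconn.nonempty
      exact ⟨l, Finset.card_le_one_of_subsingleton _⟩
    · obtain ⟨l, hl⟩ := hG.exists_vert_degree_one_of_nontrivial
      exact ⟨l, hl.le⟩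
  have hparent : ∀ y, y ≠ l → ∃ p, G.Adj y p ∧ G.dist l y = G.dist l p + 1 := by
    intro y hy
    obtain ⟨p, hp, hlp⟩ := exists_adj_mem_branch hconn hy.symm
    rw [mem_branch] at hlp
    refine ⟨p, hp, ?_⟩
    have := hG.dist_eq_dist_add_one_of_adj l hp
    omega
  -- Distance from an end vertex labels the path. Two vertices at the same distance would share a
  -- parent; together with its own parent that makes three neighbours, or two at `l`.
  have hinj : ∀ k x y, G.dist l x = k → G.dist l y = k → x = y := by
    intro k
    induction k with
    | zero =>
      intro x y hx hy
      rw [hconn.dist_eq_zero_iff] at hx hy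
      rw [← hx, ← hy]
    | succ k ih =>
      intro x y hx hy
      have hne : ∀ z, G.dist l z = k + 1 → z ≠ l := by
        rintro z hz rfl
        simp at hz
      obtain ⟨p, hp, hpd⟩ := hparent x (hne x hx)
      obtain ⟨q, hq, hqd⟩ := hparent y (hne y hy)
      obtain rfl : p = q := ih p q (by omega) (by omega)
      by_contra hxy
      have hpl : p ≠ l := by
        rintro rfl
        exact hxy (Finset.card_le_one.mp hl x (by simpa using hp.symm) y (by simpa using hq.symm))
      obtain ⟨r, hr, hrd⟩ := hparent p hpl
      have h3 : 2 < (G.neighborFinset p).card := by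
        refine Finset.two_lt_card.mpr ⟨x, by simpa using hp.symm, y, by simpa using hq.symm,
          r, by simpa using hr, hxy, ?_, ?_⟩ <;> rintro rfl <;> omega
      exact absurd (hdeg p) (by omega)
  have hlt : ∀ x, G.dist l x < Fintype.card V := by
    intro x
    obtain ⟨p, hp, hpl⟩ := hconn.exists_path_of_dist l x
    exact hpl ▸ hp.length_lt
  let f : V → Fin (Fintype.card V) := fun x => ⟨G.dist l x, hlt x⟩
  have hf : Function.Bijective f := by
    rw [Fintype.bijective_iff_injective_and_card]
    exact ⟨fun x y hxy => hinj _ x y rfl (Fin.mk.inj_iff.mp hxy).symm, by simp⟩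
  have hadj : ∀ x y, G.dist l x + 1 = G.dist l y → G.Adj x y := by
    intro x y hxy
    obtain ⟨p, hp, hpd⟩ := hparent y (by
      rintro rfl
      simp at hxy)
    obtain rfl := hinj _ x p rfl (by omega)
    exact hp.symm
  refine ⟨⟨Equiv.ofBijective f hf, fun {x y} => ?_⟩⟩
  rw [pathGraph_adj]
  refine ⟨fun h => ?_, fun h => ?_⟩
  · exact h.elim (hadj x y) fun h => (hadj y x h).symm
  · exact (hG.dist_eq_dist_add_one_of_adj l h).symm.imp Eq.symm Eq.symm

/-- A spanning tree of the path has maximum degree at most two, so it is isomorphic to the path,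
which is therefore a tree itself. -/
lemma isTree_pathGraph {n : ℕ} (hn : 1 ≤ n) : (pathGraph n).IsTree := by
  classical
  obtain ⟨m, rfl⟩ := Nat.exists_eq_add_of_le' hn
  obtain ⟨T, hle, hT⟩ := (pathGraph_connected m).exists_isTree_le
  have hdeg : ∀ v, (T.neighborFinset v).card ≤ 2 := by
    intro v
    have hsub : (T.neighborFinset v).image Fin.val ⊆ {v.val - 1, v.val + 1} := by
      intro k hk
      rw [Finset.mem_image] at hk
      obtain ⟨w, hw, rfl⟩ := hk
      rw [mem_neighborFinset] at hw
      have := pathGraph_adj.mp (hle hw)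
      rw [Finset.mem_insert, Finset.mem_singleton]
      omega
    rw [← Finset.card_image_of_injective _ Fin.val_injective]
    exact (Finset.card_le_card hsub).trans Finset.card_le_two
  obtain ⟨e⟩ := nonempty_iso_pathGraph hT hdeg
  rw [Fintype.card_fin] at e
  exact e.isTree_iff.mp hT

end PathIso

/-! ### Identification of the minimizers -/

section Minimizers

open SimpleGraph

variable {V : Type*} [Fintype V] {T : SimpleGraph V}

/-- If a graph `H` on as many vertices is a tree with spectral sum at most `s`, and all trees on `V`
not isomorphic to `H` have a larger spectral sum, then the copies of `H` are the minimizers. -/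
lemma isMinTree_iff_of_lt {W : Type*} [Fintype W] {H : SimpleGraph W} (hH : H.IsTree)
    (hcard : Fintype.card V = Fintype.card W) {s : ℝ} (hs : spectralSum H ≤ s)
    (hlt : ∀ G : SimpleGraph V, G.IsTree → ¬Nonempty (G ≃g H) → s < spectralSum G) :
    IsMinTree T ↔ Nonempty (T ≃g H) := by
  constructor
  · rintro ⟨hT, hmin⟩
    by_contra hiso
    let e := Iso.comap (Fintype.equivOfCardEq hcard) H
    have := hmin _ (e.isTree_iff.mpr hH)
    rw [spectralSum_eq_of_iso e] at this
    linarith [hlt T hT hiso]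
  · rintro ⟨e⟩
    refine ⟨e.isTree_iff.mpr hH, fun G hG => ?_⟩
    rw [spectralSum_eq_of_iso e]
    by_cases hiso : Nonempty (G ≃g H)
    · obtain ⟨e'⟩ := hiso
      exact (spectralSum_eq_of_iso e').ge
    · exact hs.trans (hlt G hG hiso).le

lemma isMinTree_iff_nonempty_iso_pathGraph (h : 16 ≤ Fintype.card V) :
    IsMinTree T ↔ Nonempty (T ≃g pathGraph (Fintype.card V)) := by
  classical
  refine isMinTree_iff_of_lt (isTree_pathGraph (by omega)) (by simp)
    (spectralSum_pathGraph_le (by omega)) fun G hG hiso => ?_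
  refine pathSum_lt_spectralSum hG h ?_
  by_contra hc
  push Not at hc
  exact hiso (nonempty_iso_pathGraph hG fun v => Nat.le_of_lt_succ (hc v))

lemma exists_forall_adj_of_card_le_three (hT : T.IsTree) (h3 : Fintype.card V ≤ 3) :
    ∃ z, ∀ x, x ≠ z → T.Adj z x := by
  classical
  suffices ∃ z, ∀ w, T.Adj z w → (branch T z w).card ≤ 1 by
    obtain ⟨z, hz⟩ := this
    exact ⟨z, fun x hx => adj_of_card_branch_le_one hT hz hx⟩
  by_cases h : 3 ≤ Fintype.card V
  · obtain ⟨N, hN, hc, hz | ⟨u, w, huw, hb, hba, -, -⟩⟩ := exists_center hT h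
    · have := two_mul_add_one_le_card hT hc
      obtain rfl : N = 1 := by omega
      exact hz
    · have := card_branch_add_card_branch hT huw
      omega
  · obtain ⟨z⟩ := hT.connected.nonempty
    refine ⟨z, fun w hw => ?_⟩
    have h1 := card_branch_add_card_branch hT hw
    have h2 := one_le_card_branch hw.symm
    omega

lemma isMinTree_iff_nonempty_iso_star (h2 : 2 ≤ Fintype.card V) (h15 : Fintype.card V ≤ 15) :
    IsMinTree T ↔ Nonempty (T ≃g completeBipartiteGraph (Fin 1) (Fin (Fintype.card V - 1))) := by
  classical
  obtain ⟨z⟩ : Nonempty V := Fintype.card_pos_iff.mp (by omega)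
  obtain ⟨e⟩ := nonempty_starGraph_iso z
  refine isMinTree_iff_of_lt (e.isTree_iff.mp (isTree_starGraph z)) (Fintype.card_congr e.toEquiv)
    ((spectralSum_eq_of_iso e).symm.trans_le (spectralSum_starGraph_le h2 z)) fun G hG hiso => ?_
  have hstar : ¬∃ z, ∀ x, x ≠ z → G.Adj z x := by
    rintro ⟨z', hz'⟩
    rw [eq_starGraph hG hz'] at hiso
    exact hiso (nonempty_starGraph_iso z')
  refine sqrt_lt_spectralSum hG ?_ h15 hstar
  by_contra hc
  exact hstar (exists_forall_adj_of_card_le_three hG (by omega))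

end Minimizers

end TreeSpectralSum
/-- For `n ≥ 16` the trees on `n` vertices that minimize the spectral sum are exactly the copies of
the path `P_n`; for `2 ≤ n ≤ 15` they are exactly the copies of the star `K_{1,n-1}`. -/
theorem theorem1p8 (n : ℕ) {V : Type*} [Fintype V] (hV : Fintype.card V = n)
    (T : SimpleGraph V) :
    (16 ≤ n →
      (TreeSpectralSum.IsMinTree T ↔ Nonempty (T ≃g SimpleGraph.pathGraph n))) ∧
    (2 ≤ n → n ≤ 15 →
      (TreeSpectralSum.IsMinTree T ↔
        Nonempty (T ≃g completeBipartiteGraph (Fin 1) (Fin (n - 1))))) := by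
  subst hV
  exact ⟨fun h => TreeSpectralSum.isMinTree_iff_nonempty_iso_pathGraph h,
    fun h2 h15 => TreeSpectralSum.isMinTree_iff_nonempty_iso_star h2 h15⟩
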